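/- All graphs are finite and nonempty, have no loops, and may have multiple edges; $d_H(v)$ denotes the number of edges of $H$ incident to $v$ (parallel edges counted separately). For a graph $G$ and $S\subseteq V(G)$, let $\omega(G\setminus S)$ be the number of connected components of the graph obtained from $G$ by deleting the vertices of $S$ (so it is $0$ if $S=V(G)$). $G$ is called $2$-tree-connected if it has two edge-disjoint spanning trees, and, for a real $t>0$, $t$-tough if $\omega(G\setminus S)\le\max\{1,\tfrac1t|S|\}$ for all $S\subseteq V(G)$. A $\{2,4\}$-factor of $G$ is a spanning subgraph $H$ of $G$ with $d_H(v)\in\{2,4\}$ for every vertex $v$. A graph is Eulerian if it is connected and all its degrees are even. Theorem. Let $G$ be a $2$-tree-connected graph of order at least two. If $$\omega(G\setminus S)\le \frac27|S|+\frac97\qquad\text{for all } S\subseteq V(G),$$ then $G$ has a connected $\{2,4\}$-factor. Corollary. Every $(3+\tfrac12)$-tough graph of order at least three has a connected $\{2,4\}$-factor, that is, a spanning Eulerian subgraph whose degrees all lie in $\{2,4\}$. -/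

import Mathlib

namespace Graph

/-- A multigraph is connected if it has a vertex and any two of its vertices are joined by a walk.
Parallel edges play no role here, so this is read off the underlying simple graph on `V(G)`. -/
def IsConnected {α β : Type*} (G : Graph α β) : Prop :=
  G.toSimpleGraph.Connected

/-- `ω(G)`, the number of connected components (it is `0` for the graph without vertices). -/
noncomputable def numComponents {α β : Type*} (G : Graph α β) : ℕ :=
  Nat.card G.toSimpleGraph.ConnectedComponent

/-- The degree of `v`: the number of edges incident to `v`, parallel edges being counted
separately. It is meant for graphs without loops. -/
noncomputable def degree {α β : Type*} (G : Graph α β) (v : α) : ℕ :=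
  (G.incidenceSet v).ncard

/-- A multigraph is a tree if it is connected and has no cycle. A pair of parallel edges
is a cycle of length two and a loop is a cycle of length one, so a tree is a simple graph. -/
def IsTree {α β : Type*} (T : Graph α β) : Prop :=
  T.Simple ∧ T.toSimpleGraph.IsTree

/-- `G` is `m`-tree-connected: it has `m` pairwise edge-disjoint spanning trees. -/
def IsTreeConnected {α β : Type*} (G : Graph α β) (m : ℕ) : Prop :=
  ∃ T : Fin m → Graph α β, (∀ i, T i ≤s G ∧ (T i).IsTree) ∧
    ∀ i j, i ≠ j → Disjoint (T i).edgeSet (T j).edgeSet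

/-- `G` is `t`-tough: `ω(G ∖ S) ≤ max {1, |S| / t}` for every set `S` of vertices. -/
def IsTough {α β : Type*} (G : Graph α β) (t : ℝ) : Prop :=
  ∀ S : Set α, S ⊆ G.vertexSet →
    ((G.deleteVerts S).numComponents : ℝ) ≤ max 1 (1 / t * (S.ncard : ℝ))

/-- `H` is an `A`-factor of `G`: a spanning subgraph of `G` all of whose degrees lie in `A`. -/
def IsFactor {α β : Type*} (H G : Graph α β) (A : Set ℕ) : Prop :=
  H ≤s G ∧ ∀ v ∈ H.vertexSet, H.degree v ∈ A

/-- A multigraph is Eulerian if it is connected and all of its degrees are even. -/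
def IsEulerian {α β : Type*} (H : Graph α β) : Prop :=
  H.IsConnected ∧ ∀ v ∈ H.vertexSet, Even (H.degree v)

end Graph

/-!
Among the edge sets `H` of pairs of edge-disjoint spanning trees of `G`, which are the `2`-sparse
sets for which `V(G)` is tight, choose one minimising `∑ v, max 0 (d_H(v) - 5)`.

If all degrees of `H` are at most `5`, write `H = T₁ ∪ T₂`. Any prescription of parities with even
sum is realised by some `F ⊆ T₂`, so `F` can be chosen to make all degrees of `T₁ ∪ F` even, and
`T₁ ∪ F` is the required factor.

Otherwise start from the vertices of degree greater than `5` and repeatedly add the vertices whose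
degree cannot be brought below `5` by exchanging edges inside tight sets that avoid the vertices
collected so far. The resulting set `S` consists of vertices of degree at least `5`, not all equal
to `5`, and minimality of `H` forces every edge of `G ∖ S` outside `H` into a tight set avoiding
`S`. Hence only edges of `H` join different classes of the partition of `V(G) ∖ S` into maximal
tight sets, and counting edges of `H` gives `4 p - 2 c ≥ 2 |S| + 10` for the number `p` of classes
and the number `c` of crossing edges. Greedy deletion of vertices and components turns this into a
set `W` with `7 ω(G ∖ (S ∪ W)) ≥ 2 |W| + 4 p - 2 c ≥ 2 |S ∪ W| + 10`, against the hypothesis; the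
constant `7` is attained by the cycle of length five.

If `G` is `7/2`-tough then a separating vertex set has at least four elements, so every edge cut has
at least `min 4 (|V(G)| - 1)` edges, and for `|V(G)| ≥ 4` the packing theorem of Nash-Williams and
Tutte yields two edge-disjoint spanning trees. For `|V(G)| = 3` the graph contains a triangle.
-/

section

open Finset
open scoped Classical

namespace Multigraph

variable {α β : Type*} {ends : β → Sym2 α}

/-- `F` is an edge set of a multigraph on the vertex set `V`: the ends of its edges lie in `V`. -/
def EdgesIn (ends : β → Sym2 α) (F : Finset β) (V : Finset α) : Prop :=
  ∀ e ∈ F, ∀ x ∈ ends e, x ∈ V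

/-- The edges of `F` with both ends in `X`. -/
noncomputable def inside (ends : β → Sym2 α) (F : Finset β) (X : Finset α) : Finset β :=
  F.filter fun e => ∀ x ∈ ends e, x ∈ X

/-- The degree of `v` in the multigraph with edge set `F`, a loop being counted only once. -/
noncomputable def deg (ends : β → Sym2 α) (F : Finset β) (v : α) : ℕ :=
  #(F.filter fun e => v ∈ ends e)

theorem EdgesIn.mono {F F' : Finset β} {V : Finset α} (h : EdgesIn ends F' V) (hF : F ⊆ F') :
    EdgesIn ends F V :=
  fun e he => h e (hF he)

theorem mem_inside {F : Finset β} {X : Finset α} {e : β} :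
    e ∈ inside ends F X ↔ e ∈ F ∧ ∀ x ∈ ends e, x ∈ X :=
  mem_filter

theorem inside_subset {F : Finset β} {X : Finset α} : inside ends F X ⊆ F :=
  filter_subset _ _

theorem inside_mono {F F' : Finset β} {X X' : Finset α} (hF : F ⊆ F') (hX : X ⊆ X') :
    inside ends F X ⊆ inside ends F' X' := by
  intro e he
  rw [mem_inside] at he ⊢
  exact ⟨hF he.1, fun x hx => hX (he.2 x hx)⟩

theorem inside_empty (F : Finset β) : inside ends F ∅ = ∅ :=
  filter_false_of_mem fun e _ h => notMem_empty _ (h _ (Sym2.out_fst_mem (ends e)))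

theorem EdgesIn.inside_eq {F : Finset β} {V : Finset α} (h : EdgesIn ends F V) :
    inside ends F V = F :=
  filter_true_of_mem h

theorem edgesIn_inside (F : Finset β) (X : Finset α) : EdgesIn ends (inside ends F X) X :=
  fun _ he => (mem_inside.1 he).2

theorem inside_inter (F : Finset β) (X Y : Finset α) :
    inside ends F (X ∩ Y) = inside ends F X ∩ inside ends F Y := by
  ext e
  simp only [mem_inside, mem_inter]
  grind

theorem inside_inside {F : Finset β} {X Y : Finset α} (h : Y ⊆ X) :
    inside ends (inside ends F X) Y = inside ends F Y := by
  ext e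
  simp only [mem_inside]
  grind

theorem inside_congr {ends' : β → Sym2 α} {F : Finset β} (h : ∀ e ∈ F, ends' e = ends e)
    (X : Finset α) : inside ends' F X = inside ends F X :=
  filter_congr fun e he => by rw [h e he]

theorem card_inside_add_le (F : Finset β) (X Y : Finset α) :
    #(inside ends F X) + #(inside ends F Y) ≤
      #(inside ends F (X ∪ Y)) + #(inside ends F (X ∩ Y)) := by
  rw [inside_inter, ← card_union_add_card_inter]
  gcongr
  exact union_subset (inside_mono subset_rfl subset_union_left)
    (inside_mono subset_rfl subset_union_right)

theorem deg_mono {F F' : Finset β} (h : F ⊆ F') (v : α) : deg ends F v ≤ deg ends F' v :=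
  card_le_card (filter_subset_filter _ h)

theorem deg_congr {F F' : Finset β} {v : α} (h : ∀ e, v ∈ ends e → (e ∈ F ↔ e ∈ F')) :
    deg ends F v = deg ends F' v :=
  congrArg card <| by ext e; simp only [mem_filter]; grind

theorem deg_insert {F : Finset β} {e : β} (he : e ∉ F) (v : α) :
    deg ends (insert e F) v = deg ends F v + if v ∈ ends e then 1 else 0 := by
  rw [deg, filter_insert]
  split_ifs
  · rw [card_insert_of_notMem (by simp [he]), deg]
  · rfl

theorem deg_erase_add {F : Finset β} {e : β} (he : e ∈ F) (v : α) :
    deg ends (F.erase e) v + (if v ∈ ends e then 1 else 0) = deg ends F v := by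
  rw [← deg_insert (notMem_erase e F), insert_erase he]

theorem sum_deg_add_card_inside {F : Finset β} {V : Finset α} (hF : EdgesIn ends F V)
    (hl : ∀ e ∈ F, ¬ (ends e).IsDiag) (S : Finset α) :
    ∑ v ∈ S, deg ends F v + #(inside ends F (V \ S)) = #F + #(inside ends F S) := by
  have hdeg : ∑ v ∈ S, deg ends F v = ∑ e ∈ F, #(S.filter fun v => v ∈ ends e) :=
    sum_card_bipartiteAbove_eq_sum_card_bipartiteBelow (fun v e => v ∈ ends e)
  rw [hdeg, inside, inside, card_filter, card_filter, card_eq_sum_ones F, ← sum_add_distrib,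
    ← sum_add_distrib]
  refine sum_congr rfl fun e he => ?_
  have hV := hF e he
  have hd := hl e he
  induction hz : ends e with | _ a b =>
  rw [hz] at hV hd
  rw [Sym2.mk_isDiag_iff] at hd
  simp only [Sym2.mem_iff, forall_eq_or_imp, forall_eq, mem_sdiff] at hV ⊢
  have hends : S.filter (fun v => v = a ∨ v = b) = S ∩ {a, b} := by
    ext; simp
  rw [hends]
  by_cases ha : a ∈ S <;> by_cases hb : b ∈ S <;> simp [ha, hb, hV, card_pair hd]

theorem sum_deg_eq_two_mul_card {F : Finset β} {V : Finset α} (hF : EdgesIn ends F V)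
    (hl : ∀ e ∈ F, ¬ (ends e).IsDiag) : ∑ v ∈ V, deg ends F v = 2 * #F := by
  have h := sum_deg_add_card_inside hF hl V
  rw [Finset.sdiff_self, inside_empty, hF.inside_eq, card_empty] at h
  omega

theorem inside_erase_eq_sdiff (F : Finset β) (X : Finset α) (v : α) :
    inside ends F (X.erase v) = inside ends F X \ (inside ends F X).filter fun e => v ∈ ends e := by
  ext e
  simp only [mem_inside, mem_sdiff, mem_filter, mem_erase]
  grind

theorem card_inside_erase_add_deg (F : Finset β) (X : Finset α) (v : α) :
    #(inside ends F (X.erase v)) + deg ends (inside ends F X) v = #(inside ends F X) := by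
  rw [inside_erase_eq_sdiff, deg, card_sdiff_add_card_eq_card (filter_subset _ _)]

/-- Every nonempty vertex set `X` spans at most `k (|X| - 1)` edges of `F`; for an edge set this is
independence in the union of `k` copies of the graphic matroid. -/
def Sparse (ends : β → Sym2 α) (k : ℕ) (F : Finset β) : Prop :=
  ∀ X : Finset α, X.Nonempty → #(inside ends F X) + k ≤ k * #X

/-- The nonempty vertex set `X` spans exactly `k (|X| - 1)` edges of `F`; when `F` is sparse these
edges decompose into `k` spanning trees of `X`. -/
def Tight (ends : β → Sym2 α) (k : ℕ) (F : Finset β) (X : Finset α) : Prop :=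
  X.Nonempty ∧ #(inside ends F X) + k = k * #X

section Sparse

variable {k : ℕ} {F : Finset β}

theorem mul_card_union_add_mul_card_inter (k : ℕ) (X Y : Finset α) :
    k * #(X ∪ Y) + k * #(X ∩ Y) = k * #X + k * #Y := by
  rw [← mul_add, card_union_add_card_inter, mul_add]

theorem mul_card_erase_add {X : Finset α} {v : α} (k : ℕ) (hv : v ∈ X) :
    k * #(X.erase v) + k = k * #X := by
  rw [← card_erase_add_one hv, mul_add_one]

theorem Sparse.mono {F' : Finset β} (h : Sparse ends k F') (hF : F ⊆ F') : Sparse ends k F :=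
  fun X hX => (Nat.add_le_add_right (card_le_card (inside_mono hF subset_rfl)) k).trans (h X hX)

theorem Sparse.not_isDiag (h : Sparse ends k F) {e : β} (he : e ∈ F) : ¬ (ends e).IsDiag := by
  intro hd
  obtain ⟨x, hx⟩ : ∃ x, ends e = s(x, x) := by
    induction hz : ends e with | _ a b => rw [hz] at hd; exact ⟨a, by rw [Sym2.mk_isDiag_iff.1 hd]⟩
  have hcard := h {x} (singleton_nonempty x)
  have hpos : 0 < #(inside ends F {x}) := card_pos.2 ⟨e, mem_inside.2 ⟨he, by simp [hx]⟩⟩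
  rw [card_singleton] at hcard
  omega

theorem Sparse.tight_singleton (h : Sparse ends k F) (v : α) : Tight ends k F {v} := by
  refine ⟨singleton_nonempty v, ?_⟩
  have := h {v} (singleton_nonempty v)
  rw [card_singleton] at this ⊢
  omega

theorem Tight.congr {F' : Finset β} {X : Finset α} (h : Tight ends k F X)
    (h' : inside ends F' X = inside ends F X) : Tight ends k F' X :=
  ⟨h.1, by rw [h']; exact h.2⟩

theorem Tight.union_and_inter (h : Sparse ends k F) {X Y : Finset α} (hX : Tight ends k F X)
    (hY : Tight ends k F Y) (hXY : (X ∩ Y).Nonempty) :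
    Tight ends k F (X ∪ Y) ∧ Tight ends k F (X ∩ Y) := by
  have hne : (X ∪ Y).Nonempty := hX.1.mono subset_union_left
  have hsup := card_inside_add_le (ends := ends) F X Y
  have hmod := mul_card_union_add_mul_card_inter k X Y
  have hX' := hX.2
  have hY' := hY.2
  have hunion := h _ hne
  have hinter := h _ hXY
  exact ⟨⟨hne, by omega⟩, ⟨hXY, by omega⟩⟩

theorem Tight.union (h : Sparse ends k F) {X Y : Finset α} (hX : Tight ends k F X)
    (hY : Tight ends k F Y) (hXY : (X ∩ Y).Nonempty) : Tight ends k F (X ∪ Y) :=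
  (hX.union_and_inter h hY hXY).1

theorem Tight.union_union (h : Sparse ends k F) {X A B : Finset α} (hX : Tight ends k F X)
    (hA : Tight ends k F A) (hB : Tight ends k F B) {x y : α} (hxX : x ∈ X) (hxA : x ∈ A)
    (hyX : y ∈ X) (hyB : y ∈ B) : Tight ends k F (X ∪ (A ∪ B)) := by
  rw [← union_assoc]
  exact (hX.union h hA ⟨x, mem_inter.2 ⟨hxX, hxA⟩⟩).union h hB
    ⟨y, mem_inter.2 ⟨mem_union_left _ hyX, hyB⟩⟩

theorem Tight.inter (h : Sparse ends k F) {X Y : Finset α} (hX : Tight ends k F X)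
    (hY : Tight ends k F Y) (hXY : (X ∩ Y).Nonempty) : Tight ends k F (X ∩ Y) :=
  (hX.union_and_inter h hY hXY).2

theorem Tight.le_deg (h : Sparse ends k F) {X : Finset α} (hX : Tight ends k F X) {v w : α}
    (hv : v ∈ X) (hw : w ∈ X) (hvw : w ≠ v) : k ≤ deg ends (inside ends F X) v := by
  have herase := h (X.erase v) ⟨w, mem_erase.2 ⟨hvw, hw⟩⟩
  have hsplit := card_inside_erase_add_deg (ends := ends) F X v
  have hcard := mul_card_erase_add k hv
  have hX' := hX.2
  omega

theorem Tight.exists_mem_ends (hk : 0 < k) (h : Sparse ends k F) {X : Finset α}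
    (hX : Tight ends k F X) {v w : α} (hv : v ∈ X) (hw : w ∈ X) (hvw : w ≠ v) :
    ∃ f ∈ inside ends F X, v ∈ ends f := by
  obtain ⟨f, hf⟩ := card_pos.1 (hk.trans_le (hX.le_deg h hv hw hvw))
  exact ⟨f, mem_filter.1 hf⟩

theorem inside_insert_of_mem {e : β} {X : Finset α} (he : ∀ x ∈ ends e, x ∈ X) :
    inside ends (insert e F) X = insert e (inside ends F X) := by
  rw [inside, filter_insert, if_pos he, inside]

theorem inside_insert_of_notMem {e : β} {X : Finset α} (he : ¬ ∀ x ∈ ends e, x ∈ X) :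
    inside ends (insert e F) X = inside ends F X := by
  rw [inside, filter_insert, if_neg he, inside]

theorem Sparse.exists_tight_of_not_insert (h : Sparse ends k F) {e : β}
    (hn : ¬ Sparse ends k (insert e F)) : ∃ X, Tight ends k F X ∧ ∀ x ∈ ends e, x ∈ X := by
  simp only [Sparse, not_forall] at hn
  obtain ⟨X, hX, hlt⟩ := hn
  have hle := h X hX
  by_cases he : ∀ x ∈ ends e, x ∈ X
  · have := card_insert_le e (inside ends F X)
    rw [inside_insert_of_mem he] at hlt
    exact ⟨X, ⟨hX, by omega⟩, he⟩
  · rw [inside_insert_of_notMem he] at hlt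
    exact absurd hle hlt

theorem Sparse.exists_isLeast_tight (h : Sparse ends k F) {x y : α} {X : Finset α}
    (hX : Tight ends k F X) (hx : x ∈ X) (hy : y ∈ X) :
    ∃ X₀, IsLeast {Y | Tight ends k F Y ∧ x ∈ Y ∧ y ∈ Y} X₀ := by
  obtain ⟨X₀, hX₀, hmin⟩ := exists_min_image
    (X.powerset.filter fun Y => Tight ends k F Y ∧ x ∈ Y ∧ y ∈ Y) card
    ⟨X, by simp [hX, hx, hy]⟩
  simp only [mem_filter, mem_powerset] at hX₀ hmin
  obtain ⟨hX₀X, hX₀, hx₀, hy₀⟩ := hX₀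
  refine ⟨X₀, ⟨hX₀, hx₀, hy₀⟩, fun Y ⟨hY, hxY, hyY⟩ => ?_⟩
  have hxXY : x ∈ X₀ ∩ Y := mem_inter.2 ⟨hx₀, hxY⟩
  have hle := hmin (X₀ ∩ Y) ⟨inter_subset_left.trans hX₀X, hX₀.inter h hY ⟨x, hxXY⟩, hxXY,
    mem_inter.2 ⟨hy₀, hyY⟩⟩
  rw [← eq_of_subset_of_card_le inter_subset_left hle]
  exact inter_subset_right

theorem Sparse.exists_isGreatest_tight (h : Sparse ends k F) {U : Finset α} {v : α} (hv : v ∈ U) :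
    ∃ P, IsGreatest {X | X ⊆ U ∧ Tight ends k F X ∧ v ∈ X} P := by
  obtain ⟨P, hP, hmax⟩ := exists_max_image
    (U.powerset.filter fun X => Tight ends k F X ∧ v ∈ X) card
    ⟨{v}, by simp [hv, h.tight_singleton v]⟩
  simp only [mem_filter, mem_powerset] at hP hmax
  obtain ⟨hPU, hP, hvP⟩ := hP
  refine ⟨P, ⟨hPU, hP, hvP⟩, fun X ⟨hXU, hX, hvX⟩ => ?_⟩
  have hle := hmax (P ∪ X) ⟨union_subset hPU hXU, hP.union h hX ⟨v, mem_inter.2 ⟨hvP, hvX⟩⟩,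
    mem_union_left _ hvP⟩
  rw [eq_of_subset_of_card_le subset_union_left hle]
  exact subset_union_right

theorem Sparse.exchange (h : Sparse ends k F) {e f : β} {x y : α} (he : ends e = s(x, y))
    {X₀ : Finset α} (hX₀ : IsLeast {Y | Tight ends k F Y ∧ x ∈ Y ∧ y ∈ Y} X₀)
    (hf : f ∈ inside ends F X₀) : Sparse ends k (insert e (F.erase f)) := by
  by_contra hn
  obtain ⟨X, hX, heX⟩ := (h.mono (erase_subset f F)).exists_tight_of_not_insert hn
  rw [he] at heX
  have hle : #(inside ends (F.erase f) X) ≤ #(inside ends F X) :=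
    card_le_card (inside_mono (erase_subset _ _) subset_rfl)
  have hX' := hX.2
  have hsparse := h X hX.1
  have hXF : Tight ends k F X := ⟨hX.1, by omega⟩
  have hfX : f ∈ inside ends F X :=
    inside_mono subset_rfl (hX₀.2 ⟨hXF, heX x (by simp), heX y (by simp)⟩) hf
  have hlt : #(inside ends (F.erase f) X) < #(inside ends F X) :=
    card_lt_card <| ssubset_iff_of_subset (inside_mono (erase_subset _ _) subset_rfl) |>.2
      ⟨f, hfX, by simp [mem_inside]⟩
  omega

end Sparse

section LocalChange

variable {k : ℕ} {H H' H₁ H₂ : Finset β} {A B C X : Finset α}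

/-- The edge set which agrees with `G` inside `C` and with `F` elsewhere. -/
noncomputable def replace (ends : β → Sym2 α) (F G : Finset β) (C : Finset α) : Finset β :=
  (F \ inside ends F C) ∪ inside ends G C

theorem mem_replace {F G : Finset β} {e : β} :
    e ∈ replace ends F G C ↔
      (e ∈ F ∧ ¬ ∀ x ∈ ends e, x ∈ C) ∨ (e ∈ G ∧ ∀ x ∈ ends e, x ∈ C) := by
  simp only [replace, mem_union, mem_sdiff, mem_inside]
  tauto

theorem replace_subset_union (F G : Finset β) : replace ends F G C ⊆ F ∪ G :=
  union_subset_union sdiff_subset inside_subset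

theorem inside_replace_of_subset {F G : Finset β} (h : X ⊆ C) :
    inside ends (replace ends F G C) X = inside ends G X := by
  ext e
  simp only [mem_inside, mem_replace]
  grind

theorem card_inside_replace (F G : Finset β) :
    #(inside ends (replace ends F G C) X) + #(inside ends F (X ∩ C)) =
      #(inside ends F X) + #(inside ends G (X ∩ C)) := by
  have hunion : inside ends (replace ends F G C) X =
      (inside ends F X \ inside ends F (X ∩ C)) ∪ inside ends G (X ∩ C) := by
    ext e
    simp only [mem_inside, mem_replace, mem_union, mem_sdiff, mem_inter]
    grind
  have hdisj : Disjoint (inside ends F X \ inside ends F (X ∩ C)) (inside ends G (X ∩ C)) := by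
    rw [disjoint_left]
    intro e
    simp only [mem_inside, mem_sdiff, mem_inter]
    grind
  have hsub := inside_mono (ends := ends) (subset_refl F) (inter_subset_left (s₁ := X) (s₂ := C))
  rw [hunion, card_union_of_disjoint hdisj, add_right_comm, card_sdiff_add_card_eq_card hsub]

theorem Sparse.replace {F G : Finset β} (hF : Sparse ends k F) (hG : Sparse ends k G)
    (hFC : Tight ends k F C) : Sparse ends k (replace ends F G C) := by
  intro X hX
  have hcard := card_inside_replace (ends := ends) (C := C) (X := X) F G
  rcases (X ∩ C).eq_empty_or_nonempty with he | hne
  · rw [he, inside_empty, inside_empty] at hcard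
    have := hF X hX
    omega
  · have hunion := hF (X ∪ C) (hX.mono subset_union_left)
    have hsup := card_inside_add_le (ends := ends) F X C
    have hmod := mul_card_union_add_mul_card_inter k X C
    have hGX := hG _ hne
    have hFC' := hFC.2
    omega

/-- The sparse edge set `H'` arises from `H` by changing the edges inside `C` only, and `C` is tight
before and after the change. -/
structure LocalChange (ends : β → Sym2 α) (k : ℕ) (H H' : Finset β) (C : Finset α) : Prop where
  sparse : Sparse ends k H'
  tight : Tight ends k H C
  tight' : Tight ends k H' C
  mem_iff : ∀ ⦃e⦄, (¬ ∀ x ∈ ends e, x ∈ C) → (e ∈ H' ↔ e ∈ H)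

namespace LocalChange

theorem refl (hH : Sparse ends k H) (hC : Tight ends k H C) : LocalChange ends k H H C :=
  ⟨hH, hC, hC, fun _ _ => Iff.rfl⟩

theorem trans (h₁ : LocalChange ends k H H₁ C) (h₂ : LocalChange ends k H₁ H₂ C) :
    LocalChange ends k H H₂ C :=
  ⟨h₂.sparse, h₁.tight, h₂.tight', fun _ he => (h₂.mem_iff he).trans (h₁.mem_iff he)⟩

theorem deg_eq (h : LocalChange ends k H H' C) {v : α} (hv : v ∉ C) :
    deg ends H' v = deg ends H v :=
  deg_congr fun _ he => h.mem_iff fun hC => hv (hC v he)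

theorem inside_eq (h : LocalChange ends k H H' C) (hX : Disjoint X C) :
    inside ends H' X = inside ends H X := by
  ext e
  simp only [mem_inside]
  refine and_congr_left fun heX => h.mem_iff fun heC => ?_
  exact disjoint_left.1 hX (heX _ (Sym2.out_fst_mem (ends e))) (heC _ (Sym2.out_fst_mem (ends e)))

theorem card_inside_eq (h : LocalChange ends k H H' C) (hCX : C ⊆ X) :
    #(inside ends H' X) = #(inside ends H X) := by
  have hsdiff : inside ends H' X \ inside ends H' C = inside ends H X \ inside ends H C := by
    ext e
    have := h.mem_iff (e := e)
    simp only [mem_sdiff, mem_inside]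
    tauto
  rw [← card_sdiff_add_card_eq_card (inside_mono (subset_refl H) hCX), ← hsdiff,
    ← card_sdiff_add_card_eq_card (inside_mono (subset_refl H') hCX)]
  have := h.tight.2
  have := h.tight'.2
  omega

theorem tight_iff (h : LocalChange ends k H H' C) (hCX : C ⊆ X) :
    Tight ends k H' X ↔ Tight ends k H X := by
  rw [Tight, Tight, h.card_inside_eq hCX]

theorem mono (h : LocalChange ends k H H' C) (hCX : C ⊆ X) (hX : Tight ends k H X) :
    LocalChange ends k H H' X :=
  ⟨h.sparse, hX, (h.tight_iff hCX).2 hX, fun _ he =>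
    h.mem_iff fun hC => he fun x hx => hCX (hC x hx)⟩

theorem exists_common (h₁ : LocalChange ends k H H₁ A) (h₂ : LocalChange ends k H H₂ B)
    (hAB : Disjoint A B) :
    ∃ K ⊆ H₁ ∪ H₂, LocalChange ends k H₁ K B ∧ LocalChange ends k H₂ K A := by
  have hB : Tight ends k H₁ B := h₂.tight.congr (h₁.inside_eq hAB.symm)
  have h₁K : LocalChange ends k H₁ (replace ends H₁ H₂ B) B :=
    ⟨h₁.sparse.replace h₂.sparse hB, hB, h₂.tight'.congr (inside_replace_of_subset subset_rfl),
      fun e he => by rw [mem_replace]; tauto⟩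
  refine ⟨replace ends H₁ H₂ B, replace_subset_union _ _, h₁K, h₁K.sparse,
    h₁.tight.congr (h₂.inside_eq hAB), h₁.tight'.congr (h₁K.inside_eq hAB), fun e he => ?_⟩
  have hH₁ := h₁.mem_iff he
  have hH₂ := h₂.mem_iff (e := e)
  rw [mem_replace]
  tauto

end LocalChange

theorem Sparse.exists_swap (hk : 0 < k) (hH : Sparse ends k H) {e : β} {x y z : α} (he : e ∉ H)
    (hxy : ends e = s(x, y)) (hX : IsLeast {Y | Tight ends k H Y ∧ x ∈ Y ∧ y ∈ Y} X)
    (hz : z ∈ X) (hze : z ∉ ends e) :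
    ∃ H' ⊆ insert e H, LocalChange ends k H H' X ∧ deg ends H' z < deg ends H z ∧
      ∀ u, deg ends H' u ≤ deg ends H u + if u ∈ ends e then 1 else 0 := by
  obtain ⟨hXt, hxX, hyX⟩ := hX.1
  have hxz : x ≠ z := by rintro rfl; simp [hxy] at hze
  obtain ⟨f, hf, hzf⟩ := hXt.exists_mem_ends hk hH hz hxX hxz
  obtain ⟨hfH, hfX⟩ := mem_inside.1 hf
  have hef : e ∉ H.erase f := fun h => he (mem_of_mem_erase h)
  have heX : ∀ u ∈ ends e, u ∈ X := by simp [hxy, hxX, hyX]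
  have hdeg : ∀ u, deg ends (insert e (H.erase f)) u + (if u ∈ ends f then 1 else 0) =
      deg ends H u + if u ∈ ends e then 1 else 0 := fun u => by
    rw [deg_insert hef, add_right_comm, deg_erase_add hfH]
  refine ⟨insert e (H.erase f), insert_subset_insert e (erase_subset f H), ⟨hH.exchange hxy hX hf,
    hXt, ⟨hXt.1, ?_⟩, fun g hg => ?_⟩, ?_, fun u => ?_⟩
  · have herase : inside ends (H.erase f) X = (inside ends H X).erase f := filter_erase ..
    rw [inside_insert_of_mem heX, herase, card_insert_of_notMem (by simp [mem_inside, he]),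
      card_erase_add_one hf, hXt.2]
  · have hge : g ≠ e := by rintro rfl; exact hg heX
    have hgf : g ≠ f := by rintro rfl; exact hg hfX
    simp [hge, hgf]
  · have := hdeg z
    rw [if_pos hzf, if_neg hze] at this
    omega
  · have := hdeg u
    omega

end LocalChange

section Obstruction

variable {k : ℕ} {E H : Finset β} {h : α → ℕ}

/-- By a change of `H` within `E` inside a tight subset of `R`, the degrees in that subset can be
made at most `h`, and the degree of its element `v` less than `h v`. -/
def Reducible (ends : β → Sym2 α) (k : ℕ) (E H : Finset β) (h : α → ℕ) (R : Finset α) (v : α) :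
    Prop :=
  ∃ C ⊆ R, v ∈ C ∧ ∃ H' ⊆ E, LocalChange ends k H H' C ∧ (∀ u ∈ C, deg ends H' u ≤ h u) ∧
    deg ends H' v < h v

theorem reducible_of_deg_lt (hH : Sparse ends k H) (hHE : H ⊆ E) {R : Finset α} {v : α}
    (hv : v ∈ R) (hdeg : deg ends H v < h v) : Reducible ends k E H h R v :=
  ⟨{v}, by simpa, by simp, H, hHE, .refl hH (hH.tight_singleton v), by simpa using hdeg.le, hdeg⟩

theorem Reducible.exists_common (hH : Sparse ends k H) {R X₀ : Finset α} {x y z : α} {e : β}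
    (heH : e ∉ H) (hxy : ends e = s(x, y)) (hx : Reducible ends k E H h R x)
    (hy : Reducible ends k E H h R y)
    (hleast : IsLeast {Y | Tight ends k H Y ∧ x ∈ Y ∧ y ∈ Y} X₀) (hzX : z ∈ X₀) (hzR : z ∉ R) :
    ∃ D ⊆ R, x ∈ D ∧ y ∈ D ∧ Tight ends k H (X₀ ∪ D) ∧ ∃ K ⊆ E, Sparse ends k K ∧ e ∉ K ∧
      (∀ X, Tight ends k H X → D ⊆ X → LocalChange ends k H K X) ∧
      (∀ X, Tight ends k K X → x ∈ X → y ∈ X → Tight ends k H (X ∪ D)) ∧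
      (∀ u ∈ D, deg ends K u + (if u ∈ ends e then 1 else 0) ≤ h u) ∧
      ∀ u ∉ D, deg ends K u = deg ends H u := by
  obtain ⟨A, hAR, hxA, Hx, hHxE, hA, hAdeg, hAx⟩ := hx
  obtain ⟨B, hBR, hyB, Hy, hHyE, hB, hBdeg, hBy⟩ := hy
  obtain ⟨hX₀, hxX, hyX⟩ : Tight ends k H X₀ ∧ x ∈ X₀ ∧ y ∈ X₀ := hleast.1
  have hAB : Disjoint A B := by
    rw [disjoint_iff_inter_eq_empty]
    by_contra hne
    have hunion := hA.tight.union hH hB.tight (nonempty_iff_ne_empty.2 hne)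
    exact hzR <| union_subset hAR hBR <|
      hleast.2 ⟨hunion, mem_union_left _ hxA, mem_union_right _ hyB⟩ hzX
  have hxB : x ∉ B := disjoint_left.1 hAB hxA
  have hyA : y ∉ A := disjoint_right.1 hAB hyB
  obtain ⟨K, hK, hxK, hyK⟩ := hA.exists_common hB hAB
  have hHK : ∀ X, Tight ends k H X → A ∪ B ⊆ X → LocalChange ends k H K X := fun X hX hABX => by
    have hH₁ := hA.mono (subset_union_left.trans hABX) hX
    exact hH₁.trans (hxK.mono (subset_union_right.trans hABX) hH₁.tight')
  refine ⟨A ∪ B, union_subset hAR hBR, mem_union_left _ hxA, mem_union_right _ hyB,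
    hX₀.union_union hH hA.tight hB.tight hxX hxA hyX hyB, K, hK.trans (union_subset hHxE hHyE),
    hxK.sparse, ?_, hHK, fun X hX hxX hyX => ?_, fun u hu => ?_, fun u hu => ?_⟩
  · rwa [hxK.mem_iff (fun h => hxB (h x (by simp [hxy]))),
      hA.mem_iff (fun h => hyA (h y (by simp [hxy])))]
  · have hXAB := hX.union_union hxK.sparse hyK.tight' hxK.tight' hxX hxA hyX hyB
    have hABX : A ∪ B ⊆ X ∪ (A ∪ B) := subset_union_right
    exact (hA.tight_iff (subset_union_left.trans hABX)).1
      ((hxK.tight_iff (subset_union_right.trans hABX)).1 hXAB)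
  · rcases mem_union.1 hu with hu | hu
    · have huy : u ≠ y := by rintro rfl; exact hyA hu
      have := hAdeg u hu
      rw [hxK.deg_eq (disjoint_left.1 hAB hu)]
      grind
    · have hux : u ≠ x := by rintro rfl; exact hxB hu
      have := hBdeg u hu
      rw [hyK.deg_eq (disjoint_right.1 hAB hu)]
      grind
  · rw [mem_union, not_or] at hu
    rw [hxK.deg_eq hu.2, hA.deg_eq hu.1]

theorem Reducible.exists_swap (hk : 0 < k) (hH : Sparse ends k H) {R X₀ : Finset α} {x y z : α}
    {e : β} (heE : e ∈ E) (heH : e ∉ H) (hxy : ends e = s(x, y))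
    (hx : Reducible ends k E H h R x) (hy : Reducible ends k E H h R y)
    (hX₀ : IsLeast {Y | Tight ends k H Y ∧ x ∈ Y ∧ y ∈ Y} X₀) (hzX : z ∈ X₀) (hzR : z ∉ R) :
    ∃ C, X₀ ⊆ C ∧ C ⊆ X₀ ∪ R ∧ ∃ H' ⊆ E, LocalChange ends k H H' C ∧
      (∀ u ∈ C, deg ends H' u ≤ max (h u) (deg ends H u)) ∧ deg ends H' z < deg ends H z := by
  obtain ⟨D, hDR, hxD, hyD, hC, K, hKE, hK, heK, hHK, hKH, hdegD, hdeg⟩ :=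
    hx.exists_common hH heH hxy hy hX₀ hzX hzR
  have hzD : z ∉ D := fun hz => hzR (hDR hz)
  have hKC := hHK _ hC subset_union_right
  obtain ⟨X₁, hX₁⟩ := hK.exists_isLeast_tight hKC.tight'
    (mem_union_right X₀ hxD) (mem_union_right X₀ hyD)
  obtain ⟨hX₁t, hxX₁, hyX₁⟩ : Tight ends k K X₁ ∧ x ∈ X₁ ∧ y ∈ X₁ := hX₁.1
  have hX₁C : X₁ ⊆ X₀ ∪ D :=
    hX₁.2 ⟨hKC.tight', mem_union_right _ hxD, mem_union_right _ hyD⟩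
  have hzX₁ : z ∈ X₁ := by
    have := hX₀.2 ⟨hKH X₁ hX₁t hxX₁ hyX₁, mem_union_left _ hxX₁, mem_union_left _ hyX₁⟩ hzX
    exact (mem_union.1 this).resolve_right hzD
  have hze : z ∉ ends e := by
    rw [hxy, Sym2.mem_iff]
    rintro (rfl | rfl) <;> contradiction
  obtain ⟨H', hH', hKH', hdegz, hdeg'⟩ := hK.exists_swap hk heK hxy hX₁ hzX₁ hze
  refine ⟨X₀ ∪ D, subset_union_left, union_subset_union subset_rfl hDR, H',
    hH'.trans (insert_subset heE hKE), hKC.trans (hKH'.mono hX₁C hKC.tight'), fun u _ => ?_,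
    hdeg z hzD ▸ hdegz⟩
  by_cases hu : u ∈ D
  · exact ((hdeg' u).trans (hdegD u hu)).trans (le_max_left _ _)
  · have hue : u ∉ ends e := by
      rw [hxy, Sym2.mem_iff]
      rintro (rfl | rfl) <;> contradiction
    have := hdeg' u
    rw [if_neg hue, hdeg u hu] at this
    exact this.trans (le_max_right _ _)

/-- The increasing sequence of vertex sets that starts with the vertices of degree greater than `h`
and in each step adds the vertices which are not reducible off the current set. -/
noncomputable def obstruction (ends : β → Sym2 α) (k : ℕ) (E H : Finset β) (h : α → ℕ)
    (V : Finset α) : ℕ → Finset α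
  | 0 => V.filter fun v => h v < deg ends H v
  | n + 1 => obstruction ends k E H h V n ∪
      V.filter fun v => ¬ Reducible ends k E H h (V \ obstruction ends k E H h V n) v

variable {V : Finset α} {n : ℕ}

theorem obstruction_zero_subset (n : ℕ) :
    obstruction ends k E H h V 0 ⊆ obstruction ends k E H h V n := by
  induction n with
  | zero => rfl
  | succ n ih => exact ih.trans subset_union_left

theorem deg_le_of_notMem_obstruction {v : α} (hv : v ∈ V)
    (hn : v ∉ obstruction ends k E H h V n) : deg ends H v ≤ h v :=
  not_lt.1 fun hlt => hn (obstruction_zero_subset n (mem_filter.2 ⟨hv, hlt⟩))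

theorem reducible_of_notMem_obstruction {v : α} (hv : v ∈ V)
    (hn : v ∉ obstruction ends k E H h V (n + 1)) :
    Reducible ends k E H h (V \ obstruction ends k E H h V n) v :=
  of_not_not fun hr => hn (mem_union_right _ (mem_filter.2 ⟨hv, hr⟩))

theorem le_deg_of_mem_obstruction (hH : Sparse ends k H) (hHE : H ⊆ E) {v : α}
    (hv : v ∈ obstruction ends k E H h V n) : h v ≤ deg ends H v := by
  induction n with
  | zero => exact (mem_filter.1 hv).2.le
  | succ n ih =>
    by_cases hvn : v ∈ obstruction ends k E H h V n
    · exact ih hvn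
    obtain ⟨hvV, hnot⟩ := mem_filter.1 ((mem_union.1 hv).resolve_left hvn)
    by_contra! hlt
    exact hnot (reducible_of_deg_lt hH hHE (mem_sdiff.2 ⟨hvV, hvn⟩) hlt)

theorem disjoint_obstruction_of_minimal (hk : 0 < k) (hH : Sparse ends k H)
    (hHV : Tight ends k H V)
    (hmin : ∀ H' ⊆ E, Sparse ends k H' → Tight ends k H' V →
      ∑ v ∈ V, (deg ends H v - h v) ≤ ∑ v ∈ V, (deg ends H' v - h v))
    {e : β} {x y : α} {X₀ : Finset α} (heE : e ∈ E) (heH : e ∉ H) (hxy : ends e = s(x, y))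
    (hx : x ∈ V) (hy : y ∈ V) (hxn : ∀ n, x ∉ obstruction ends k E H h V n)
    (hyn : ∀ n, y ∉ obstruction ends k E H h V n)
    (hX₀ : IsLeast {Y | Tight ends k H Y ∧ x ∈ Y ∧ y ∈ Y} X₀) (n : ℕ) :
    Disjoint X₀ (obstruction ends k E H h V n) := by
  have hX₀V : X₀ ⊆ V := hX₀.2 ⟨hHV, hx, hy⟩
  have hswap (n : ℕ) {z : α} (hzX : z ∈ X₀) (hz : z ∈ obstruction ends k E H h V n) :=
    Reducible.exists_swap hk hH heE heH hxy (reducible_of_notMem_obstruction hx (hxn (n + 1)))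
      (reducible_of_notMem_obstruction hy (hyn (n + 1))) hX₀ hzX fun h => (mem_sdiff.1 h).2 hz
  induction n with
  | zero =>
    refine disjoint_left.2 fun z hzX hz => ?_
    obtain ⟨C, -, hC, H', hH'E, hHH', hdeg, hdegz⟩ := hswap 0 hzX hz
    have hCV : C ⊆ V := hC.trans (union_subset hX₀V sdiff_subset)
    have hz' := (mem_filter.1 hz).2
    refine (hmin H' hH'E hHH'.sparse ((hHH'.tight_iff hCV).2 hHV)).not_gt <|
      sum_lt_sum (fun u _ => ?_) ⟨z, hX₀V hzX, by omega⟩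
    by_cases hu : u ∈ C
    · have := hdeg u hu
      omega
    · rw [hHH'.deg_eq hu]
  | succ n ih =>
    refine disjoint_left.2 fun z hzX hz => ?_
    obtain ⟨-, hnot⟩ :=
      mem_filter.1 ((mem_union.1 hz).resolve_left (disjoint_left.1 ih hzX))
    obtain ⟨C, hX₀C, hC, H', hH'E, hHH', hdeg, hdegz⟩ := hswap (n + 1) hzX hz
    have hCn : C ⊆ V \ obstruction ends k E H h V n :=
      hC.trans <| union_subset (subset_sdiff.2 ⟨hX₀V, ih⟩) <|
        sdiff_subset_sdiff subset_rfl subset_union_left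
    have hle : ∀ u ∈ C, deg ends H u ≤ h u := fun u hu =>
      deg_le_of_notMem_obstruction (mem_sdiff.1 (hCn hu)).1 (mem_sdiff.1 (hCn hu)).2
    exact hnot ⟨C, hCn, hX₀C hzX, H', hH'E, hHH',
      fun u hu => (hdeg u hu).trans_eq (max_eq_left (hle u hu)), hdegz.trans_le (hle z (hX₀C hzX))⟩

theorem exists_deg_le_or_obstruction (hk : 0 < k) (h : α → ℕ) {H₀ : Finset β} (hH₀E : H₀ ⊆ E)
    (hH₀ : Sparse ends k H₀) (hH₀V : Tight ends k H₀ V) :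
    ∃ H ⊆ E, Sparse ends k H ∧ Tight ends k H V ∧ ((∀ v ∈ V, deg ends H v ≤ h v) ∨
      ∃ S ⊆ V, (∀ v ∈ S, h v ≤ deg ends H v) ∧ (∃ v ∈ S, h v < deg ends H v) ∧
        ∀ e ∈ E, e ∉ H → (∀ x ∈ ends e, x ∈ V \ S) →
          ∃ X ⊆ V \ S, Tight ends k H X ∧ ∀ x ∈ ends e, x ∈ X) := by
  obtain ⟨H, hHm, hmin⟩ := exists_min_image
    (E.powerset.filter fun H => Sparse ends k H ∧ Tight ends k H V)
    (fun H => ∑ v ∈ V, (deg ends H v - h v)) ⟨H₀, by simp [*]⟩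
  simp only [mem_filter, mem_powerset, and_imp] at hHm hmin
  obtain ⟨hHE, hH, hHV⟩ := hHm
  refine ⟨H, hHE, hH, hHV, or_iff_not_imp_left.2 fun hdeg => ?_⟩
  push Not at hdeg
  obtain ⟨w, hwV, hw⟩ := hdeg
  refine ⟨V.filter fun v => ∃ n, v ∈ obstruction ends k E H h V n, filter_subset _ _,
    fun v hv => ?_, ⟨w, mem_filter.2 ⟨hwV, 0, mem_filter.2 ⟨hwV, hw⟩⟩, hw⟩,
    fun e heE heH heV => ?_⟩
  · obtain ⟨-, n, hn⟩ := mem_filter.1 hv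
    exact le_deg_of_mem_obstruction hH hHE hn
  induction he : ends e with | _ x y =>
  simp only [he, Sym2.mem_iff, forall_eq_or_imp, forall_eq, mem_sdiff, mem_filter, not_and,
    not_exists] at heV
  obtain ⟨⟨hxV, hxU⟩, hyV, hyU⟩ := heV
  obtain ⟨X₀, hX₀⟩ := hH.exists_isLeast_tight hHV hxV hyV
  have hdisj := disjoint_obstruction_of_minimal hk hH hHV hmin heE heH he hxV hyV
    (hxU hxV) (hyU hyV) hX₀
  refine ⟨X₀, fun z hz => mem_sdiff.2 ⟨hX₀.2 ⟨hHV, hxV, hyV⟩ hz, fun hzS => ?_⟩, hX₀.1.1,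
    by simpa using hX₀.1.2⟩
  obtain ⟨-, n, hn⟩ := mem_filter.1 hzS
  exact disjoint_left.1 (hdisj n) hz hn

end Obstruction

section Connects

variable {k : ℕ} {F H H₀ T T' : Finset β} {V : Finset α} {v a b : α} {e f g : β}

/-- The edges of `F` connect the vertices in `V`: every cut of `V` is crossed by an edge of `F`. -/
def Connects (ends : β → Sym2 α) (F : Finset β) (V : Finset α) : Prop :=
  ∀ A : Finset α, (∃ x ∈ V, x ∈ A) → (∃ y ∈ V, y ∉ A) →
    ∃ e ∈ F, ∃ x y, ends e = s(x, y) ∧ x ∈ A ∧ y ∉ A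

theorem Connects.congr {ends' : β → Sym2 α} (h : Connects ends' T V)
    (he : ∀ e ∈ T, ends' e = ends e) : Connects ends T V := by
  intro A hx hy
  obtain ⟨e, heT, x, y, hxy, h⟩ := h A hx hy
  exact ⟨e, heT, x, y, (he e heT) ▸ hxy, h⟩

theorem Connects.mono (h : Connects ends T V) (hT : T ⊆ T') : Connects ends T' V := by
  intro A hx hy
  obtain ⟨e, heT, h⟩ := h A hx hy
  exact ⟨e, hT heT, h⟩

theorem connects_of_card_le_one (F : Finset β) (hV : #V ≤ 1) : Connects ends F V := by
  rintro A ⟨x, hx, hxA⟩ ⟨y, hy, hyA⟩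
  exact absurd (card_le_one.1 hV x hx y hy ▸ hxA) hyA

theorem Connects.insert_pendant (h : Connects ends T (V.erase v)) (he : ends e = s(v, a))
    (ha : a ∈ V.erase v) : Connects ends (insert e T) V := by
  rintro A ⟨x, hxV, hx⟩ ⟨y, hyV, hy⟩
  by_cases haA : a ∈ A <;> by_cases hvA : v ∈ A
  · obtain ⟨f, hf, hfA⟩ := h A ⟨a, ha, haA⟩ ⟨y, by grind, hy⟩
    exact ⟨f, mem_insert_of_mem hf, hfA⟩
  · exact ⟨e, mem_insert_self _ _, a, v, by rw [he, Sym2.eq_swap], haA, hvA⟩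
  · exact ⟨e, mem_insert_self _ _, v, a, he, hvA, haA⟩
  · obtain ⟨f, hf, hfA⟩ := h A ⟨x, by grind, hx⟩ ⟨a, ha, haA⟩
    exact ⟨f, mem_insert_of_mem hf, hfA⟩

theorem Connects.subdivide (h : Connects (Function.update ends e s(a, b)) T (V.erase v))
    (he : ends e = s(v, a)) (hf : ends f = s(v, b)) (ha : a ∈ V.erase v) (heT : e ∈ T) :
    Connects ends (insert f T) V := by
  rintro A ⟨x, hxV, hx⟩ ⟨y, hyV, hy⟩
  have of_iff : (a ∈ A ↔ b ∈ A) → (∃ x ∈ V.erase v, x ∈ A) → (∃ y ∈ V.erase v, y ∉ A) →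
      ∃ g ∈ insert f T, ∃ x y, ends g = s(x, y) ∧ x ∈ A ∧ y ∉ A := by
    intro hab hx hy
    obtain ⟨g, hg, p, q, hpq, hp, hq⟩ := h A hx hy
    have hge : g ≠ e := by
      rintro rfl
      rw [Function.update_self, Sym2.eq_iff] at hpq
      grind
    rw [Function.update_of_ne hge] at hpq
    exact ⟨g, mem_insert_of_mem hg, p, q, hpq, hp, hq⟩
  by_cases haA : a ∈ A <;> by_cases hvA : v ∈ A
  · by_cases hbA : b ∈ A
    · exact of_iff (by tauto) ⟨a, ha, haA⟩ ⟨y, by grind, hy⟩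
    · exact ⟨f, mem_insert_self _ _, v, b, hf, hvA, hbA⟩
  · exact ⟨e, mem_insert_of_mem heT, a, v, by rw [he, Sym2.eq_swap], haA, hvA⟩
  · exact ⟨e, mem_insert_of_mem heT, v, a, he, hvA, haA⟩
  · by_cases hbA : b ∈ A
    · exact ⟨f, mem_insert_self _ _, b, v, by rw [hf, Sym2.eq_swap], hbA, hvA⟩
    · exact of_iff (by tauto) ⟨x, by grind, hx⟩ ⟨a, ha, haA⟩

/-- `H` contains two disjoint edge sets each of which connects `V`, that is, the multigraph
`(V, H)` is `2`-tree-connected. -/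
def ConnectsTwice (ends : β → Sym2 α) (H : Finset β) (V : Finset α) : Prop :=
  ∃ T₁ T₂, T₁ ⊆ H ∧ T₂ ⊆ H ∧ Disjoint T₁ T₂ ∧ Connects ends T₁ V ∧ Connects ends T₂ V

theorem ConnectsTwice.mono {H' : Finset β} (h : ConnectsTwice ends H V) (hH : H ⊆ H') :
    ConnectsTwice ends H' V := by
  obtain ⟨T₁, T₂, h₁, h₂, h⟩ := h
  exact ⟨T₁, T₂, h₁.trans hH, h₂.trans hH, h⟩

theorem ConnectsTwice.insert_pendants (h : ConnectsTwice ends H (V.erase v)) (heH : e ∉ H)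
    (hfH : f ∉ H) (hef : e ≠ f) (he : ends e = s(v, a)) (hf : ends f = s(v, b))
    (ha : a ∈ V.erase v) (hb : b ∈ V.erase v) :
    ConnectsTwice ends (insert e (insert f H)) V := by
  obtain ⟨T₁, T₂, h₁, h₂, hd, hc₁, hc₂⟩ := h
  refine ⟨insert e T₁, insert f T₂, by grind, by grind, ?_, hc₁.insert_pendant he ha,
    hc₂.insert_pendant hf hb⟩
  rw [disjoint_insert_left, disjoint_insert_right]
  grind

theorem ConnectsTwice.of_split
    (h : ConnectsTwice (Function.update ends e s(a, b)) (insert e H) (V.erase v))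
    (hfH : f ∉ H) (hgH : g ∉ H) (hef : e ≠ f) (heg : e ≠ g) (hfg : f ≠ g)
    (he : ends e = s(v, a)) (hf : ends f = s(v, b)) {c : α} (hg : ends g = s(v, c))
    (ha : a ∈ V.erase v) (hc : c ∈ V.erase v) :
    ConnectsTwice ends (insert e (insert f (insert g H))) V := by
  have of_notMem : ∀ {T}, e ∉ T → Connects (Function.update ends e s(a, b)) T (V.erase v) →
      Connects ends T (V.erase v) := fun he h =>
    h.congr fun x hx => Function.update_of_ne (ne_of_mem_of_not_mem hx he) _ _
  obtain ⟨T₁, T₂, h₁, h₂, hd, heT₂, hc₁, hc₂⟩ : ∃ T₁ T₂, T₁ ⊆ insert e H ∧ T₂ ⊆ insert e H ∧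
      Disjoint T₁ T₂ ∧ e ∉ T₂ ∧ Connects (Function.update ends e s(a, b)) T₁ (V.erase v) ∧
      Connects (Function.update ends e s(a, b)) T₂ (V.erase v) := by
    obtain ⟨T₁, T₂, h₁, h₂, hd, hc₁, hc₂⟩ := h
    by_cases he : e ∈ T₂
    · exact ⟨T₂, T₁, h₂, h₁, hd.symm, disjoint_right.1 hd he, hc₂, hc₁⟩
    · exact ⟨T₁, T₂, h₁, h₂, hd, he, hc₁, hc₂⟩
  refine ⟨insert e (insert f T₁), insert g T₂, by grind, by grind, ?_, ?_,
    (of_notMem heT₂ hc₂).insert_pendant hg hc⟩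
  · simp only [disjoint_insert_left, disjoint_insert_right]
    grind
  · by_cases heT₁ : e ∈ T₁
    · exact (hc₁.subdivide he hf ha heT₁).mono (subset_insert _ _)
    · exact ((of_notMem heT₁ hc₁).insert_pendant he ha).mono
        (insert_subset_insert _ (subset_insert _ _))

theorem Sparse.insert_update (h : Sparse ends k H) (he : e ∉ H)
    (hab : ¬ ∃ X, Tight ends k H X ∧ a ∈ X ∧ b ∈ X) :
    Sparse (Function.update ends e s(a, b)) k (insert e H) := by
  have hends : ∀ x ∈ H, Function.update ends e s(a, b) x = ends x := fun x hx =>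
    Function.update_of_ne (ne_of_mem_of_not_mem hx he) _ _
  have h' : Sparse (Function.update ends e s(a, b)) k H := fun X hX => by
    rw [inside_congr hends]
    exact h X hX
  by_contra hn
  obtain ⟨X, hX, heX⟩ := h'.exists_tight_of_not_insert hn
  rw [Function.update_self] at heX
  rw [Tight, inside_congr hends] at hX
  exact hab ⟨X, hX, heX a (by simp), heX b (by simp)⟩

theorem Sparse.card_le_of_tight (h : Sparse ends k H) (hH₀ : H₀ ⊆ H) (hv : ∀ e ∈ H₀, v ∉ ends e)
    {Z : Finset α} (hZ : Tight ends k H₀ Z) {D : Finset β} (hD : D ⊆ H)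
    (hDv : ∀ e ∈ D, v ∈ ends e ∧ ∀ x ∈ ends e, x ∈ insert v Z) : #D ≤ k := by
  have hsub : D ∪ inside ends H₀ Z ⊆ inside ends H (insert v Z) :=
    union_subset (fun e he => mem_inside.2 ⟨hD he, (hDv e he).2⟩)
      (inside_mono hH₀ (subset_insert _ _))
  have hdisj : Disjoint D (inside ends H₀ Z) :=
    disjoint_left.2 fun e he he₀ => hv e (inside_subset he₀) (hDv e he).1
  have hcard := card_le_card hsub
  rw [card_union_of_disjoint hdisj] at hcard
  have hsparse := h (insert v Z) (insert_nonempty _ _)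
  have hmul := Nat.mul_le_mul_left k (card_insert_le v Z)
  have hZ' := hZ.2
  rw [mul_add_one] at hmul
  omega

theorem Sparse.exists_splittable_pair (h : Sparse ends 2 H) (hH₀ : H₀ ⊆ H)
    (hv : ∀ e ∈ H₀, v ∉ ends e) {D : Finset β} (hDH : D ⊆ H) (hD : ∀ e ∈ D, v ∈ ends e)
    (hcard : #D = 3) :
    ∃ e ∈ D, ∃ f ∈ D, ∃ g ∈ D, e ≠ f ∧ e ≠ g ∧ f ≠ g ∧ ∃ a b, ends e = s(v, a) ∧
      ends f = s(v, b) ∧ ¬ ∃ X, Tight ends 2 H₀ X ∧ a ∈ X ∧ b ∈ X := by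
  obtain ⟨e, f, g, hef, heg, hfg, rfl⟩ := card_eq_three.1 hcard
  obtain ⟨a, ha⟩ := hD e (by simp)
  obtain ⟨b, hb⟩ := hD f (by simp)
  obtain ⟨c, hc⟩ := hD g (by simp)
  by_cases hab : ∃ X, Tight ends 2 H₀ X ∧ a ∈ X ∧ b ∈ X
  swap
  · exact ⟨e, by simp, f, by simp, g, by simp, hef, heg, hfg, a, b, ha, hb, hab⟩
  refine ⟨f, by simp, g, by simp, e, by simp, hfg, hef.symm, heg.symm, b, c, hb, hc, ?_⟩
  rintro ⟨Y, hY, hbY, hcY⟩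
  obtain ⟨X, hX, haX, hbX⟩ := hab
  have hXY := hX.union (h.mono hH₀) hY ⟨b, mem_inter.2 ⟨hbX, hbY⟩⟩
  have := h.card_le_of_tight hH₀ hv hXY hDH (by simp [ha, hb, hc, haX, hbX, hcY])
  omega

theorem Tight.exists_deg_lt (hk : 0 < k) (h : Sparse ends k H) (hV : Tight ends k H V)
    (hHV : EdgesIn ends H V) : ∃ v ∈ V, deg ends H v < 2 * k := by
  by_contra! hcon
  have hsum := sum_deg_eq_two_mul_card hHV fun e he => h.not_isDiag he
  have hle := card_nsmul_le_sum V (fun v => deg ends H v) (2 * k) hcon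
  have hVk := hV.2
  rw [hHV.inside_eq] at hVk
  rw [smul_eq_mul, show #V * (2 * k) = 2 * (k * #V) by ring] at hle
  omega

theorem EdgesIn.exists_other_end (hHV : EdgesIn ends H V) (heH : e ∈ H)
    (hl : ¬ (ends e).IsDiag) (hv : v ∈ ends e) : ∃ a ∈ V.erase v, ends e = s(v, a) := by
  obtain ⟨a, ha⟩ := hv
  refine ⟨a, mem_erase.2 ⟨?_, hHV e heH a (by simp [ha])⟩, ha⟩
  rintro rfl
  exact hl (by simp [ha])

theorem EdgesIn.card_inside_erase_add_deg (hHV : EdgesIn ends H V) (v : α) :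
    #(inside ends H (V.erase v)) + deg ends H v = #H := by
  conv_rhs => rw [← hHV.inside_eq, ← Multigraph.card_inside_erase_add_deg H V v, hHV.inside_eq]

theorem Tight.inside_erase (hV : Tight ends k H V) (hHV : EdgesIn ends H V) (hv : v ∈ V)
    (hne : (V.erase v).Nonempty) (hdeg : deg ends H v = k) :
    Tight ends k (inside ends H (V.erase v)) (V.erase v) := by
  refine ⟨hne, ?_⟩
  have hcard := hHV.card_inside_erase_add_deg v
  have hmul := mul_card_erase_add k hv
  have hV' := hV.2
  rw [hHV.inside_eq] at hV'
  rw [inside_inside subset_rfl]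
  omega

theorem edgesIn_insert_update (hHV : EdgesIn ends H V) (he : e ∉ H) (ha : a ∈ V) (hb : b ∈ V) :
    EdgesIn (Function.update ends e s(a, b)) (insert e H) V := by
  intro x hx
  rcases mem_insert.1 hx with rfl | hx
  · simp [ha, hb]
  · rw [Function.update_of_ne (ne_of_mem_of_not_mem hx he)]
    exact hHV x hx

theorem notMem_inside_erase (hve : v ∈ ends e) : e ∉ inside ends H (V.erase v) := fun he =>
  notMem_erase v V ((mem_inside.1 he).2 v hve)

theorem Tight.split (hV : Tight ends k H V) (hHV : EdgesIn ends H V) (hv : v ∈ V)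
    (hdeg : deg ends H v = k + 1) (hve : v ∈ ends e) (ha : a ∈ V.erase v) (hb : b ∈ V.erase v) :
    Tight (Function.update ends e s(a, b)) k (insert e (inside ends H (V.erase v)))
      (V.erase v) := by
  have he : e ∉ inside ends H (V.erase v) := notMem_inside_erase hve
  refine ⟨⟨a, ha⟩, ?_⟩
  rw [(edgesIn_insert_update (edgesIn_inside H _) he ha hb).inside_eq, card_insert_of_notMem he]
  have hcard := hHV.card_inside_erase_add_deg v
  have hmul := mul_card_erase_add k hv
  have hV' := hV.2
  rw [hHV.inside_eq] at hV'
  omega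

theorem Sparse.connectsTwice_of_deg_eq_two (hH : Sparse ends 2 H) (hHV : EdgesIn ends H V)
    (hdeg : deg ends H v = 2)
    (hv : ConnectsTwice ends (inside ends H (V.erase v)) (V.erase v)) : ConnectsTwice ends H V := by
  obtain ⟨e, f, hef, hD⟩ := card_eq_two.1 hdeg
  obtain ⟨heH, hve⟩ := mem_filter.1 (hD ▸ mem_insert_self e {f})
  obtain ⟨hfH, hvf⟩ := mem_filter.1 (hD ▸ mem_insert_of_mem (mem_singleton_self f))
  obtain ⟨a, ha, he⟩ := hHV.exists_other_end heH (hH.not_isDiag heH) hve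
  obtain ⟨b, hb, hf⟩ := hHV.exists_other_end hfH (hH.not_isDiag hfH) hvf
  exact (hv.insert_pendants (notMem_inside_erase hve) (notMem_inside_erase hvf) hef he hf ha
    hb).mono (insert_subset heH (insert_subset hfH inside_subset))

theorem Sparse.exists_split_of_deg_eq_three (hH : Sparse ends 2 H) (hHV : EdgesIn ends H V)
    (hdeg : deg ends H v = 3) :
    ∃ e, v ∈ ends e ∧ ∃ a ∈ V.erase v, ∃ b ∈ V.erase v,
      Sparse (Function.update ends e s(a, b)) 2 (insert e (inside ends H (V.erase v))) ∧
      (ConnectsTwice (Function.update ends e s(a, b)) (insert e (inside ends H (V.erase v)))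
        (V.erase v) → ConnectsTwice ends H V) := by
  have other_end : ∀ e ∈ H.filter (fun e => v ∈ ends e), ∃ a ∈ V.erase v, ends e = s(v, a) :=
    fun e he => by
      obtain ⟨heH, hve⟩ := mem_filter.1 he
      exact hHV.exists_other_end heH (hH.not_isDiag heH) hve
  have mem_of : ∀ e ∈ H.filter (fun e => v ∈ ends e), ∀ a, ends e = s(v, a) → a ∈ V.erase v :=
    fun e heD a he => by
      obtain ⟨a', ha', he'⟩ := other_end e heD
      rwa [Sym2.congr_right.1 (he.symm.trans he')]
  obtain ⟨e, heD, f, hfD, g, hgD, hef, heg, hfg, a, b, he, hf, hab⟩ :=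
    hH.exists_splittable_pair inside_subset (fun e he hve => notMem_inside_erase hve he)
      (filter_subset _ _) (fun e he => (mem_filter.1 he).2) hdeg
  obtain ⟨c, hc, hg⟩ := other_end g hgD
  have ha := mem_of e heD a he
  obtain ⟨heH, hve⟩ := mem_filter.1 heD
  obtain ⟨hfH, hvf⟩ := mem_filter.1 hfD
  obtain ⟨hgH, hvg⟩ := mem_filter.1 hgD
  refine ⟨e, hve, a, ha, b, mem_of f hfD b hf,
    (hH.mono inside_subset).insert_update (notMem_inside_erase hve) hab, fun h => ?_⟩
  exact (h.of_split (notMem_inside_erase hvf) (notMem_inside_erase hvg) hef heg hfg he hf hg ha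
    hc).mono (insert_subset heH (insert_subset hfH (insert_subset hgH inside_subset)))

/-- Nash-Williams' theorem for two trees, by induction: a vertex of degree two is deleted, and at a
vertex of degree three a suitable pair of edges is split off. -/
theorem Tight.connectsTwice (hH : Sparse ends 2 H) (hV : Tight ends 2 H V)
    (hHV : EdgesIn ends H V) : ConnectsTwice ends H V := by
  induction V using Finset.strongInduction generalizing ends H with | _ V ih =>
  rcases Nat.lt_or_ge 1 #V with hV₂ | hV₁
  swap
  · exact ⟨∅, ∅, by simp, by simp, by simp, connects_of_card_le_one _ hV₁,
      connects_of_card_le_one _ hV₁⟩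
  obtain ⟨v, hv, hlt⟩ := hV.exists_deg_lt two_pos hH hHV
  obtain ⟨w, hw⟩ : (V.erase v).Nonempty := (erase_nonempty hv).2 (one_lt_card_iff_nontrivial.1 hV₂)
  have hle := hV.le_deg hH hv (mem_of_mem_erase hw) (ne_of_mem_erase hw)
  rw [hHV.inside_eq] at hle
  rcases (show deg ends H v = 2 ∨ deg ends H v = 3 by omega) with htwo | hthree
  · exact hH.connectsTwice_of_deg_eq_two hHV htwo <| ih _ (erase_ssubset hv)
      (hH.mono inside_subset) (hV.inside_erase hHV hv ⟨w, hw⟩ htwo) (edgesIn_inside H _)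
  · obtain ⟨e, hve, a, ha, b, hb, hsparse, hsplit⟩ := hH.exists_split_of_deg_eq_three hHV hthree
    exact hsplit <| ih _ (erase_ssubset hv) hsparse (hV.split hHV hv hthree hve ha hb)
      (edgesIn_insert_update (edgesIn_inside H _) (notMem_inside_erase hve) ha hb)

end Connects

section EvenSubgraph

variable {T T₁ T₂ H : Finset β} {V : Finset α}

/-- The mod `2` boundary map of the multigraph with edge set `T`, from edge chains to vertex
chains; chains are functions with values in `ZMod 2`. -/
noncomputable def boundary (ends : β → Sym2 α) (T : Finset β) :
    (β → ZMod 2) →ₗ[ZMod 2] (α → ZMod 2) :=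
  LinearMap.pi fun v => ∑ e ∈ T with v ∈ ends e, LinearMap.proj e

theorem boundary_apply (χ : β → ZMod 2) (v : α) :
    boundary ends T χ v = ∑ e ∈ T with v ∈ ends e, χ e := by
  simp [boundary]

theorem boundary_single {e : β} (he : e ∈ T) {p q : α} (hpq : ends e = s(p, q)) (hne : p ≠ q) :
    boundary ends T (Pi.single e 1) = Pi.single p 1 + Pi.single q 1 := by
  ext v
  have hsupp : v ∈ ends e ↔ v = p ∨ v = q := by rw [hpq, Sym2.mem_iff]
  simp only [boundary_apply, Pi.add_apply, Pi.single_apply, sum_ite_eq', mem_filter, he, true_and,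
    hsupp]
  grind

theorem natCast_deg_eq_boundary (χ : β → ZMod 2) (v : α) :
    (deg ends (T.filter fun e => χ e = 1) v : ZMod 2) = boundary ends T χ v := by
  rw [boundary_apply, deg, filter_filter, card_filter, sum_filter, Nat.cast_sum]
  refine sum_congr rfl fun e _ => ?_
  have zero_or_one : ∀ a : ZMod 2, a = 0 ∨ a = 1 := by decide
  rcases zero_or_one (χ e) with h | h <;> simp [h]

theorem Connects.single_add_single_mem_range_boundary (hT : Connects ends T V)
    (hTV : EdgesIn ends T V) {x y : α} (hx : x ∈ V) (hy : y ∈ V) :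
    Pi.single x 1 + Pi.single y 1 ∈ LinearMap.range (boundary ends T) := by
  by_contra hxy
  obtain ⟨e, heT, p, q, he, hp, hq⟩ :=
    hT {z ∈ V | Pi.single x 1 + Pi.single z 1 ∈ LinearMap.range (boundary ends T)}
      ⟨x, hx, mem_filter.2 ⟨hx, ZModModule.add_self (Pi.single x 1 : α → ZMod 2) ▸ zero_mem _⟩⟩
      ⟨y, hy, fun h => hxy (mem_filter.1 h).2⟩
  have hpq : p ≠ q := by rintro rfl; exact hq hp
  have hqV : q ∈ V := hTV e heT q (he ▸ Sym2.mem_mk_right p q)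
  refine hq (mem_filter.2 ⟨hqV, ?_⟩)
  have hsum : (Pi.single x 1 + Pi.single q 1 : α → ZMod 2) =
      (Pi.single x 1 + Pi.single p 1) + (Pi.single p 1 + Pi.single q 1) := by
    rw [add_assoc, ← add_assoc (Pi.single p 1), ZModModule.add_self, zero_add]
  rw [hsum]
  exact add_mem (mem_filter.1 hp).2 ⟨_, boundary_single heT he hpq⟩

theorem Connects.exists_subset_natCast_deg_eq (hT : Connects ends T V) (hTV : EdgesIn ends T V)
    {f : α → ZMod 2} (hf : ∑ v ∈ V, f v = 0) :
    ∃ F ⊆ T, ∀ v ∈ V, (deg ends F v : ZMod 2) = f v := by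
  obtain rfl | ⟨r, hr⟩ := V.eq_empty_or_nonempty
  · exact ⟨∅, empty_subset _, by simp⟩
  obtain ⟨χ, hχ⟩ : ∑ v ∈ V, f v • (Pi.single r 1 + Pi.single v 1 : α → ZMod 2) ∈
      LinearMap.range (boundary ends T) :=
    sum_mem fun v hv => Submodule.smul_mem _ _
      (hT.single_add_single_mem_range_boundary hTV hr hv)
  refine ⟨T.filter fun e => χ e = 1, filter_subset _ _, fun v hv => ?_⟩
  rw [natCast_deg_eq_boundary, hχ]
  simp_rw [smul_add, sum_add_distrib, ← sum_smul, hf, zero_smul, zero_add, ← Pi.single_smul',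
    smul_eq_mul, mul_one]
  rw [Finset.sum_apply, sum_pi_single, if_pos hv]

theorem Connects.exists_even (hT : Connects ends T₂ V) (hd : Disjoint T₁ T₂)
    (h₁ : EdgesIn ends T₁ V) (h₂ : EdgesIn ends T₂ V) (hl : ∀ e ∈ T₁, ¬ (ends e).IsDiag) :
    ∃ F ⊆ T₂, ∀ v ∈ V, Even (deg ends (T₁ ∪ F) v) := by
  have hsum : ∑ v ∈ V, (deg ends T₁ v : ZMod 2) = 0 := by
    rw [← Nat.cast_sum, sum_deg_eq_two_mul_card h₁ hl, ZMod.natCast_eq_zero_iff_even]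
    exact even_two_mul _
  obtain ⟨F, hF, hdeg⟩ := hT.exists_subset_natCast_deg_eq h₂ hsum
  refine ⟨F, hF, fun v hv => ?_⟩
  rw [← ZMod.natCast_eq_zero_iff_even, deg, filter_union,
    card_union_of_disjoint (disjoint_filter_filter (hd.mono_right hF)), Nat.cast_add, ← deg,
    ← deg, hdeg v hv, ZModModule.add_self]

theorem Tight.exists_connects_even (hH : Sparse ends 2 H) (hV : Tight ends 2 H V)
    (hHV : EdgesIn ends H V) : ∃ J ⊆ H, Connects ends J V ∧ ∀ v ∈ V, Even (deg ends J v) := by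
  obtain ⟨T₁, T₂, h₁, h₂, hd, hc₁, hc₂⟩ := hV.connectsTwice hH hHV
  obtain ⟨F, hF, hJ⟩ := hc₂.exists_even hd (hHV.mono h₁) (hHV.mono h₂)
    fun e he => hH.not_isDiag (h₁ he)
  exact ⟨T₁ ∪ F, union_subset h₁ (hF.trans h₂), hc₁.mono subset_union_left, hJ⟩

end EvenSubgraph

section Partition

variable {ι : Type*} {k : ℕ} {E F H : Finset β} {U : Finset α} {π : α → ι}

/-- The edges of `F` joining different classes of the partition into the fibres of `π`. -/
noncomputable def crossing (ends : β → Sym2 α) (F : Finset β) (π : α → ι) : Finset β :=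
  F.filter fun e => ∃ x ∈ ends e, ∃ y ∈ ends e, π x ≠ π y

theorem mem_crossing {e : β} :
    e ∈ crossing ends F π ↔ e ∈ F ∧ ∃ x ∈ ends e, ∃ y ∈ ends e, π x ≠ π y :=
  mem_filter

theorem crossing_subset : crossing ends F π ⊆ F :=
  filter_subset _ _

theorem crossing_mono (hF : F ⊆ E) : crossing ends F π ⊆ crossing ends E π :=
  filter_subset_filter _ hF

theorem crossing_eq_of_subset (hHE : H ⊆ E)
    (h : ∀ e ∈ E, e ∉ H → ∀ x ∈ ends e, ∀ y ∈ ends e, π x = π y) :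
    crossing ends E π = crossing ends H π := by
  ext e
  simp only [mem_crossing]
  grind

theorem card_crossing_add_sum_card_inside [DecidableEq ι] (hF : EdgesIn ends F U)
    (π : α → ι) :
    #(crossing ends F π) + ∑ i ∈ U.image π, #(inside ends F {v ∈ U | π v = i}) = #F := by
  have hmono : #{e ∈ F | ¬ ∃ x ∈ ends e, ∃ y ∈ ends e, π x ≠ π y} =
      ∑ i ∈ U.image π, #(inside ends F {v ∈ U | π v = i}) := by
    rw [card_eq_sum_card_fiberwise (f := fun e => π (ends e).out.1) (t := U.image π)]
    · refine sum_congr rfl fun i _ => congrArg card ?_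
      ext e
      have hout := Sym2.out_fst_mem (ends e)
      have hU := hF e
      simp only [mem_inside, mem_filter]
      grind
    · intro e he
      exact mem_image_of_mem _ (hF e (mem_filter.1 he).1 _ (Sym2.out_fst_mem _))
  rw [← hmono, crossing, card_filter_add_card_filter_not]

theorem card_add_mul_card_image_eq [DecidableEq ι] (hF : EdgesIn ends F U)
    (hπ : ∀ v ∈ U, Tight ends k F {w ∈ U | π w = π v}) :
    #F + k * #(U.image π) = k * #U + #(crossing ends F π) := by
  have htight : ∑ i ∈ U.image π, (#(inside ends F {v ∈ U | π v = i}) + k) =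
      ∑ i ∈ U.image π, k * #{v ∈ U | π v = i} := by
    refine sum_congr rfl fun i hi => ?_
    obtain ⟨v, hv, rfl⟩ := mem_image.1 hi
    exact (hπ v hv).2
  rw [sum_add_distrib, ← mul_sum, ← card_eq_sum_card_image, sum_const, smul_eq_mul,
    mul_comm #_] at htight
  have hcount := card_crossing_add_sum_card_inside hF π
  omega

theorem Sparse.exists_tight_partition (hH : Sparse ends k H) (U : Finset α) :
    ∃ π : α → Finset α, (∀ v ∈ U, Tight ends k H {w ∈ U | π w = π v}) ∧
      ∀ X ⊆ U, Tight ends k H X → ∀ x ∈ X, ∀ y ∈ X, π x = π y := by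
  choose! π hπ using fun v (hv : v ∈ U) => hH.exists_isGreatest_tight hv
  have mem_iff : ∀ v ∈ U, ∀ w ∈ U, w ∈ π v ↔ π w = π v := by
    refine fun v hv w hw => ⟨fun hwv => ?_, fun h => h ▸ (hπ w hw).1.2.2⟩
    have hle : π v ⊆ π w := (hπ w hw).2 ⟨(hπ v hv).1.1, (hπ v hv).1.2.1, hwv⟩
    exact ((hπ v hv).2 ⟨(hπ w hw).1.1, (hπ w hw).1.2.1, hle (hπ v hv).1.2.2⟩).antisymm hle
  refine ⟨π, fun v hv => ?_, fun X hX hXt x hx y hy => ?_⟩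
  · have hclass : {w ∈ U | π w = π v} = π v := by
      ext w
      rw [mem_filter]
      exact ⟨fun h => (mem_iff v hv w h.1).2 h.2,
        fun h => ⟨(hπ v hv).1.1 h, (mem_iff v hv w ((hπ v hv).1.1 h)).1 h⟩⟩
    rw [hclass]
    exact (hπ v hv).1.2.1
  · exact (mem_iff y (hX hy) x (hX hx)).1 ((hπ y (hX hy)).2 ⟨hX, hXt, hy⟩ hx)

theorem Sparse.exists_partition (hH : Sparse ends k H) (U : Finset α) :
    ∃ π : α → Finset α,
      #(inside ends H U) + k * #(U.image π) = k * #U + #(crossing ends (inside ends H U) π) ∧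
      ∀ X ⊆ U, Tight ends k H X → ∀ x ∈ X, ∀ y ∈ X, π x = π y := by
  obtain ⟨π, hclass, hπ⟩ := hH.exists_tight_partition U
  refine ⟨π, card_add_mul_card_image_eq (edgesIn_inside H U) fun v hv => ?_, hπ⟩
  exact (hclass v hv).congr (inside_inside (filter_subset (fun w => π w = π v) U))

end Partition

section Cut

variable {E : Finset β} {U C N : Finset α} {k : ℕ} {m m' : ℤ} {v : α}

/-- The multigraph spanned by `E` on `U` has at least `k` components: the vertices of `U` can be
coloured with `k` colours so that every edge is monochromatic. -/
def SplitsInto (ends : β → Sym2 α) (E : Finset β) (U : Finset α) (k : ℕ) : Prop :=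
  ∃ c : α → ℕ, #(U.image c) = k ∧
    ∀ e ∈ inside ends E U, ∀ x ∈ ends e, ∀ y ∈ ends e, c x = c y

theorem splitsInto_empty (E : Finset β) : SplitsInto ends E ∅ 0 :=
  ⟨0, by simp, by simp [inside_empty]⟩

theorem SplitsInto.union (h : SplitsInto ends E U k) (hC : C.Nonempty) (hCU : Disjoint C U)
    (hedge : ∀ e ∈ inside ends E (C ∪ U), (∃ x ∈ ends e, x ∈ C) → ∀ x ∈ ends e, x ∈ C) :
    SplitsInto ends E (C ∪ U) (k + 1) := by
  obtain ⟨c, hcard, hc⟩ := h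
  obtain ⟨i, hi⟩ := Infinite.exists_notMem_finset (U.image c)
  have hC' : C.image (fun x => if x ∈ C then i else c x) = {i} :=
    (image_congr fun x hx => if_pos hx).trans (image_const hC i)
  have hU' : U.image (fun x => if x ∈ C then i else c x) = U.image c :=
    image_congr fun x hx => if_neg (disjoint_right.1 hCU hx)
  refine ⟨fun x => if x ∈ C then i else c x, ?_, fun e he x hx y hy => ?_⟩
  · rw [image_union, hC', hU', singleton_union, card_insert_of_notMem hi, hcard]
  · by_cases heC : ∃ z ∈ ends e, z ∈ C
    · simp only [if_pos (hedge e he heC x hx), if_pos (hedge e he heC y hy)]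
    · push Not at heC
      simp only [if_neg (heC x hx), if_neg (heC y hy)]
      refine hc e (mem_inside.2 ⟨inside_subset he, fun z hz => ?_⟩) x hx y hy
      exact (mem_union.1 ((mem_inside.1 he).2 z hz)).resolve_left (heC z hz)

/-- Deleting a suitable `W` from the multigraph spanned by `E` on `U` leaves at least `k`
components, where `2 |W| + m ≤ 7 k`; the toughness condition bounds `m` by `9`. -/
def HasCut (ends : β → Sym2 α) (E : Finset β) (U : Finset α) (m : ℤ) : Prop :=
  ∃ W ⊆ U, ∃ k : ℕ, SplitsInto ends E (U \ W) k ∧ 2 * (#W : ℤ) + m ≤ 7 * k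

theorem hasCut_empty (E : Finset β) : HasCut ends E ∅ 0 :=
  ⟨∅, subset_rfl, 0, splitsInto_empty E, by simp⟩

theorem HasCut.mono (h : HasCut ends E U m') (hm : m ≤ m') : HasCut ends E U m := by
  obtain ⟨W, hW, k, hk, hle⟩ := h
  exact ⟨W, hW, k, hk, by omega⟩

theorem HasCut.of_erase (h : HasCut ends E (U.erase v) m) (hv : v ∈ U) :
    HasCut ends E U (m - 2) := by
  obtain ⟨W, hW, k, hk, hle⟩ := h
  refine ⟨insert v W, insert_subset hv (hW.trans (erase_subset v U)), k, ?_, ?_⟩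
  · rwa [sdiff_insert, ← erase_sdiff_comm]
  · have := card_insert_le v W
    omega

theorem HasCut.of_sdiff_union (h : HasCut ends E (U \ (C ∪ N)) m) (hC : C.Nonempty) (hCU : C ⊆ U)
    (hNU : N ⊆ U) (hCN : Disjoint C N)
    (hedge : ∀ e ∈ inside ends E U, (∃ x ∈ ends e, x ∈ C) → ∀ x ∈ ends e, x ∈ C ∪ N) :
    HasCut ends E U (m + 7 - 2 * #N) := by
  obtain ⟨W, hW, k, hk, hle⟩ := h
  have hWU := hW.trans sdiff_subset
  have hCW : Disjoint C W := disjoint_sdiff.mono subset_union_left hW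
  have hrest : U \ (W ∪ N) = C ∪ (U \ (C ∪ N)) \ W := by
    ext x
    have hxU := @hCU x
    have hxN : x ∈ C → x ∉ N := fun h => disjoint_left.1 hCN h
    have hxW : x ∈ C → x ∉ W := fun h => disjoint_left.1 hCW h
    simp only [mem_sdiff, mem_union]
    tauto
  refine ⟨W ∪ N, union_subset hWU hNU, k + 1, ?_, ?_⟩
  · rw [hrest]
    refine hk.union hC (disjoint_sdiff.mono subset_union_left sdiff_subset) fun e he heC x hx => ?_
    rw [← hrest] at he
    have hxCN := hedge e (inside_mono subset_rfl sdiff_subset he) heC x hx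
    have hxW := (mem_inside.1 he).2 x hx
    grind
  · have := card_union_le W N
    push_cast
    omega

theorem HasCut.of_sdiff (h : HasCut ends E (U \ C) m) (hC : C.Nonempty) (hCU : C ⊆ U)
    (hedge : ∀ e ∈ inside ends E U, (∃ x ∈ ends e, x ∈ C) → ∀ x ∈ ends e, x ∈ C) :
    HasCut ends E U (m + 7) := by
  have := HasCut.of_sdiff_union (N := ∅) (by rwa [union_empty]) hC hCU (empty_subset U)
    (disjoint_empty_right C) (by simpa only [union_empty] using hedge)
  simpa using this

end Cut

section DegLeTwo

variable {E F : Finset β} {U R : Finset α} {m : ℤ} {b : α}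

/-- The neighbours in `U` of the vertex `b` of the multigraph with edge set `F`. -/
noncomputable def nbrs (ends : β → Sym2 α) (F : Finset β) (U : Finset α) (b : α) : Finset α :=
  {v ∈ U | ∃ e ∈ F, ends e = s(b, v)}

theorem mem_nbrs {v : α} : v ∈ nbrs ends F U b ↔ v ∈ U ∧ ∃ e ∈ F, ends e = s(b, v) :=
  mem_filter

theorem notMem_nbrs (hl : ∀ e ∈ F, ¬ (ends e).IsDiag) : b ∉ nbrs ends F U b := by
  intro h
  obtain ⟨-, e, he, hb⟩ := mem_nbrs.1 h
  exact hl e he (hb ▸ Sym2.mk_isDiag_iff.2 rfl)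

theorem mem_insert_nbrs (hF : EdgesIn ends F U) {e : β} (he : e ∈ F) (hb : b ∈ ends e) {x : α}
    (hx : x ∈ ends e) : x ∈ insert b (nbrs ends F U b) := by
  rw [mem_insert, or_iff_not_imp_left]
  exact fun hxb => mem_nbrs.2 ⟨hF e he x hx, e, he, (Sym2.mem_and_mem_iff (Ne.symm hxb)).1 ⟨hb, hx⟩⟩

theorem card_nbrs_le_deg : #(nbrs ends F U b) ≤ deg ends F b := by
  refine card_le_card_of_forall_subsingleton (fun v e => ends e = s(b, v)) (fun v hv => ?_) ?_
  · obtain ⟨-, e, he, hb⟩ := mem_nbrs.1 hv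
    exact ⟨e, mem_filter.2 ⟨he, hb ▸ Sym2.mem_mk_left b v⟩, hb⟩
  · exact fun e _ v hv w hw => Sym2.congr_right.1 (hv.2.symm.trans hw.2)

theorem deg_le_card_inside_insert_nbrs (hF : EdgesIn ends F U) :
    deg ends F b ≤ #(inside ends F (insert b (nbrs ends F U b))) := by
  refine card_le_card fun e he => ?_
  obtain ⟨heF, hb⟩ := mem_filter.1 he
  exact mem_inside.2 ⟨heF, fun x hx => mem_insert_nbrs hF heF hb hx⟩

theorem deg_inside_sdiff_lt {e : β} (he : e ∈ inside ends E U) {x y : α} (hx : x ∈ ends e)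
    (hxR : x ∈ R) (hy : y ∈ ends e) :
    deg ends (inside ends E (U \ R)) y < deg ends (inside ends E U) y := by
  have hsub : inside ends E (U \ R) ⊆ (inside ends E U).erase e := fun f hf =>
    mem_erase.2 ⟨by rintro rfl; exact (mem_sdiff.1 ((mem_inside.1 hf).2 x hx)).2 hxR,
      inside_mono subset_rfl sdiff_subset hf⟩
  have hmono := deg_mono (ends := ends) hsub y
  have herase := deg_erase_add (ends := ends) he y
  rw [if_pos hy] at herase
  omega

theorem card_inside_add_card_inside_sdiff_le (hR : R ⊆ U) (F : Finset β) :
    #(inside ends F R) + #(inside ends F (U \ R)) ≤ #(inside ends F U) := by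
  have h := card_inside_add_le (ends := ends) F R (U \ R)
  rwa [union_sdiff_of_subset hR, inter_sdiff_self, inside_empty, card_empty] at h

theorem card_inside_add_card_inside_sdiff_lt (hR : R ⊆ U) {e : β} (he : e ∈ inside ends F U)
    {x y : α} (hx : x ∈ ends e) (hxR : x ∈ R) (hy : y ∈ ends e) (hyR : y ∉ R) :
    #(inside ends F R) + #(inside ends F (U \ R)) < #(inside ends F U) := by
  have hle := card_inside_add_card_inside_sdiff_le (ends := ends) hR (F.erase e)
  have herase : ∀ X, inside ends (F.erase e) X = (inside ends F X).erase e :=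
    fun X => filter_erase _ _ _
  have hR' : e ∉ inside ends F R := fun h => hyR ((mem_inside.1 h).2 y hy)
  have hUR : e ∉ inside ends F (U \ R) := fun h =>
    (mem_sdiff.1 ((mem_inside.1 h).2 x hx)).2 hxR
  have hcard := card_erase_add_one he
  rw [herase, herase, herase, erase_eq_of_notMem hR', erase_eq_of_notMem hUR] at hle
  omega

theorem mul_card_add_card_inside_sdiff (hF : EdgesIn ends F U) (hl : ∀ e ∈ F, ¬ (ends e).IsDiag)
    {d : ℕ} (hd : ∀ v ∈ R, deg ends F v = d) :
    d * #R + #(inside ends F (U \ R)) = #F + #(inside ends F R) := by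
  rw [← sum_deg_add_card_inside hF hl R, sum_const_nat hd, mul_comm]

/-- Either `insert b (nbrs b)` is a union of components and is split off as a part of its own, or an
edge leaves it; then `nbrs b` is deleted, `b` becomes a component, and some other vertex loses an
edge. -/
theorem HasCut.of_sdiff_insert_nbrs (hl : ∀ e ∈ E, ¬ (ends e).IsDiag)
    (hdeg : ∀ v ∈ U, deg ends (inside ends E U) v ≤ 2) (hb : b ∈ U)
    (hm : m ≤ 0 ∧ (∀ v ∈ U, deg ends (inside ends E U) v = 2) ∨
      m ≤ 1 ∧ deg ends (inside ends E U) b ≤ 1)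
    (hR : R = insert b (nbrs ends (inside ends E U) U b))
    (h₀ : HasCut ends E (U \ R) (4 * #(U \ R) - 2 * #(inside ends E (U \ R))))
    (h₁ : (∃ v ∈ U \ R, deg ends (inside ends E (U \ R)) v ≤ 1) →
      HasCut ends E (U \ R) (4 * #(U \ R) - 2 * #(inside ends E (U \ R)) + 1)) :
    HasCut ends E U (4 * #U - 2 * #(inside ends E U) + m) := by
  have hF := edgesIn_inside (ends := ends) E U
  have hFl : ∀ e ∈ inside ends E U, ¬ (ends e).IsDiag := fun e he => hl e (inside_subset he)
  have hbN := notMem_nbrs (U := U) (b := b) hFl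
  have hNU : nbrs ends (inside ends E U) U b ⊆ U := filter_subset _ _
  have hRU : R ⊆ U := hR ▸ insert_subset hb hNU
  have hcardR : #R = #(nbrs ends (inside ends E U) U b) + 1 := hR ▸ card_insert_of_notMem hbN
  have hcardU := card_sdiff_add_card_eq_card hRU
  have hN := card_nbrs_le_deg (ends := ends) (F := inside ends E U) (U := U) (b := b)
  have hbR := deg_le_card_inside_insert_nbrs (b := b) hF
  rw [← hR, inside_inside hRU] at hbR
  have hb₂ := hdeg b hb
  have hsum : m ≤ 0 ∧
      2 * #R + #(inside ends E (U \ R)) = #(inside ends E U) + #(inside ends E R) ∨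
      m ≤ 1 ∧ deg ends (inside ends E U) b ≤ 1 := by
    refine hm.imp_left fun ⟨hm, htwo⟩ => ⟨hm, ?_⟩
    have := mul_card_add_card_inside_sdiff hF hFl fun v hv => htwo v (hRU hv)
    rwa [inside_inside hRU, inside_inside sdiff_subset] at this
  by_cases hclosed : ∀ e ∈ inside ends E U, (∃ x ∈ ends e, x ∈ R) → ∀ x ∈ ends e, x ∈ R
  · refine (h₀.of_sdiff (hR ▸ insert_nonempty _ _) hRU hclosed).mono ?_
    have hle := card_inside_add_card_inside_sdiff_le (ends := ends) hRU E
    omega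
  · push Not at hclosed
    obtain ⟨e, he, ⟨x, hx, hxR⟩, y, hy, hyR⟩ := hclosed
    have hyU := (mem_inside.1 he).2 y hy
    have hlt := card_inside_add_card_inside_sdiff_lt hRU he hx hxR hy hyR
    have hdegy := deg_inside_sdiff_lt he hx hxR hy
    have hcut := h₁ ⟨y, mem_sdiff.2 ⟨hyU, hyR⟩, by have := hdeg y hyU; omega⟩
    rw [hR, insert_eq] at hcut
    refine (hcut.of_sdiff_union (singleton_nonempty b) (singleton_subset_iff.2 hb) hNU
      (disjoint_singleton_left.2 hbN) fun e he ⟨z, hz, hzb⟩ w hw => ?_).mono ?_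
    · exact mem_insert_nbrs hF he (mem_singleton.1 hzb ▸ hz) hw
    · rw [← insert_eq, ← hR]
      omega

theorem hasCut_of_deg_le_two (hl : ∀ e ∈ E, ¬ (ends e).IsDiag) (U : Finset α)
    (hdeg : ∀ v ∈ U, deg ends (inside ends E U) v ≤ 2) :
    HasCut ends E U (4 * #U - 2 * #(inside ends E U)) ∧
      ((∃ v ∈ U, deg ends (inside ends E U) v ≤ 1) →
        HasCut ends E U (4 * #U - 2 * #(inside ends E U) + 1)) := by
  induction U using Finset.strongInduction with | _ U ih =>
  have hstep : ∀ b ∈ U, ∀ m : ℤ, (m ≤ 0 ∧ (∀ v ∈ U, deg ends (inside ends E U) v = 2) ∨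
      m ≤ 1 ∧ deg ends (inside ends E U) b ≤ 1) →
      HasCut ends E U (4 * #U - 2 * #(inside ends E U) + m) := by
    intro b hb m hm
    have hsub : U \ insert b (nbrs ends (inside ends E U) U b) ⊂ U :=
      sdiff_ssubset (insert_subset hb (filter_subset _ _)) (insert_nonempty _ _)
    have hrec := ih _ hsub fun v hv =>
      (deg_mono (inside_mono subset_rfl hsub.1) v).trans (hdeg v (hsub.1 hv))
    exact HasCut.of_sdiff_insert_nbrs hl hdeg hb hm rfl hrec.1 hrec.2
  have hbonus : (∃ v ∈ U, deg ends (inside ends E U) v ≤ 1) →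
      HasCut ends E U (4 * #U - 2 * #(inside ends E U) + 1) :=
    fun ⟨v, hv, hv₁⟩ => hstep v hv 1 (.inr ⟨le_rfl, hv₁⟩)
  refine ⟨?_, hbonus⟩
  obtain rfl | ⟨b, hb⟩ := U.eq_empty_or_nonempty
  · simpa [inside_empty] using hasCut_empty E
  by_cases hlow : ∃ v ∈ U, deg ends (inside ends E U) v ≤ 1
  · exact (hbonus hlow).mono (by omega)
  · push Not at hlow
    have htwo : ∀ v ∈ U, deg ends (inside ends E U) v = 2 := fun v hv =>
      (hdeg v hv).antisymm (hlow v hv)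
    simpa using hstep b hb 0 (.inl ⟨le_rfl, htwo⟩)

end DegLeTwo

section PartitionCut

variable {ι : Type*} {E : Finset β} {U : Finset α} {π : α → ι} {x : α}

theorem crossing_inside (E : Finset β) (U : Finset α) (π : α → ι) :
    crossing ends (inside ends E U) π = inside ends (crossing ends E π) U :=
  filter_comm _ _ _

theorem card_crossing_inside_erase_add_deg (E : Finset β) (U : Finset α) (π : α → ι) (x : α) :
    #(crossing ends (inside ends E (U.erase x)) π) +
        deg ends (crossing ends (inside ends E U) π) x =
      #(crossing ends (inside ends E U) π) := by
  rw [crossing_inside, crossing_inside, card_inside_erase_add_deg]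

theorem crossing_eq_self_of_injOn (hl : ∀ e ∈ E, ¬ (ends e).IsDiag) (hE : EdgesIn ends E U)
    (hπ : Set.InjOn π U) : crossing ends E π = E := by
  refine filter_true_of_mem fun e he => ?_
  have hne := hl e he
  have hU := hE e he
  induction hz : ends e with | _ a b =>
  rw [hz] at hne hU
  have ha := Sym2.mem_mk_left a b
  have hb := Sym2.mem_mk_right a b
  exact ⟨a, ha, b, hb, fun h => hne (Sym2.mk_isDiag_iff.2 (hπ (hU a ha) (hU b hb) h))⟩

variable [DecidableEq ι]

theorem image_erase_of_exists_ne (h : ∃ y ∈ U, y ≠ x ∧ π y = π x) :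
    (U.erase x).image π = U.image π := by
  obtain ⟨y, hy, hyx, hπ⟩ := h
  refine (image_subset_image (erase_subset x U)).antisymm fun i hi => ?_
  obtain ⟨z, hz, rfl⟩ := mem_image.1 hi
  obtain rfl | hzx := eq_or_ne z x
  · exact mem_image.2 ⟨y, mem_erase.2 ⟨hyx, hy⟩, hπ⟩
  · exact mem_image_of_mem π (mem_erase.2 ⟨hzx, hz⟩)

theorem card_image_le_card_image_erase_add_one : #(U.image π) ≤ #((U.erase x).image π) + 1 := by
  have hsub : U.image π ⊆ insert (π x) ((U.erase x).image π) := by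
    rw [← image_insert]
    exact image_subset_image (insert_erase_subset x U)
  exact (card_le_card hsub).trans (card_insert_le _ _)

theorem HasCut.of_crossing_erase (hx : x ∈ U)
    (h : HasCut ends E (U.erase x)
      (4 * #((U.erase x).image π) - 2 * #(crossing ends (inside ends E (U.erase x)) π)))
    (hdeg : 1 ≤ deg ends (crossing ends (inside ends E U) π) x ∧ (∃ y ∈ U, y ≠ x ∧ π y = π x) ∨
      3 ≤ deg ends (crossing ends (inside ends E U) π) x) :
    HasCut ends E U (4 * #(U.image π) - 2 * #(crossing ends (inside ends E U) π)) := by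
  refine (h.of_erase hx).mono ?_
  have hcross := card_crossing_inside_erase_add_deg (ends := ends) E U π x
  obtain ⟨hdeg, hy⟩ | hdeg := hdeg
  · rw [image_erase_of_exists_ne hy]
    omega
  · have himage := card_image_le_card_image_erase_add_one (U := U) (π := π) (x := x)
    omega

theorem HasCut.of_crossing_sdiff_class (hx : x ∈ U)
    (h : HasCut ends E (U \ {y ∈ U | π y = π x}) (4 * #((U \ {y ∈ U | π y = π x}).image π) -
      2 * #(crossing ends (inside ends E (U \ {y ∈ U | π y = π x})) π)))
    (hdeg : ∀ y ∈ U, π y = π x → deg ends (crossing ends (inside ends E U) π) y = 0) :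
    HasCut ends E U (4 * #(U.image π) - 2 * #(crossing ends (inside ends E U) π)) := by
  have hclosed : ∀ e ∈ inside ends E U, (∃ y ∈ ends e, y ∈ U.filter fun y => π y = π x) →
      ∀ y ∈ ends e, y ∈ U.filter fun y => π y = π x := by
    rintro e he ⟨y, hye, hy⟩ z hze
    obtain ⟨hyU, hyx⟩ := mem_filter.1 hy
    refine mem_filter.2 ⟨(mem_inside.1 he).2 z hze, ?_⟩
    by_contra hzx
    have hcross : e ∈ crossing ends (inside ends E U) π :=
      mem_crossing.2 ⟨he, z, hze, y, hye, hyx ▸ hzx⟩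
    exact notMem_empty e (card_eq_zero.1 (hdeg y hyU hyx) ▸ mem_filter.2 ⟨hcross, hye⟩)
  refine (h.of_sdiff ⟨x, mem_filter.2 ⟨hx, rfl⟩⟩ (filter_subset _ _) hclosed).mono ?_
  have himage : U.image π ⊆ insert (π x) ((U \ {y ∈ U | π y = π x}).image π) := by
    intro i hi
    obtain ⟨z, hz, rfl⟩ := mem_image.1 hi
    rw [mem_insert, or_iff_not_imp_left]
    exact fun hzx => mem_image_of_mem π
      (mem_sdiff.2 ⟨hz, fun h => hzx (mem_filter.1 h).2⟩)
  have hcard := (card_le_card himage).trans (card_insert_le _ _)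
  have hcross := card_le_card (crossing_mono (ends := ends) (π := π)
    (inside_mono (ends := ends) (subset_refl E)
      (sdiff_subset : U \ {y ∈ U | π y = π x} ⊆ U)))
  omega

theorem hasCut_of_partition (hl : ∀ e ∈ E, ¬ (ends e).IsDiag) (U : Finset α) (π : α → ι) :
    HasCut ends E U (4 * #(U.image π) - 2 * #(crossing ends (inside ends E U) π)) := by
  induction U using Finset.strongInduction with | _ U ih =>
  by_cases herase : ∃ x ∈ U, 1 ≤ deg ends (crossing ends (inside ends E U) π) x ∧
      (∃ y ∈ U, y ≠ x ∧ π y = π x) ∨ 3 ≤ deg ends (crossing ends (inside ends E U) π) x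
  · obtain ⟨x, hx, hdeg⟩ := herase
    exact HasCut.of_crossing_erase hx (ih _ (erase_ssubset hx)) hdeg
  push Not at herase
  by_cases hinj : Set.InjOn π U
  · have hcross : crossing ends (inside ends E U) π = inside ends E U :=
      crossing_eq_self_of_injOn (fun e he => hl e (inside_subset he)) (edgesIn_inside E U) hinj
    rw [card_image_of_injOn hinj, hcross]
    refine (hasCut_of_deg_le_two hl U fun v hv => ?_).1
    have := (herase v hv).2
    rw [hcross] at this
    omega
  · have hclass : ∃ x ∈ U, ∃ y ∈ U, π x = π y ∧ x ≠ y := by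
      simpa only [Set.InjOn, not_forall, exists_prop, mem_coe] using hinj
    obtain ⟨x, hx, y, hy, hxy, hne⟩ := hclass
    refine HasCut.of_crossing_sdiff_class hx (ih _ (sdiff_ssubset (filter_subset _ _)
      ⟨x, mem_filter.2 ⟨hx, rfl⟩⟩)) fun z hz hzx => ?_
    by_contra hdeg
    obtain rfl | hzx' := eq_or_ne z x
    · exact (herase z hz).1 (Nat.one_le_iff_ne_zero.2 hdeg) y hy hne.symm hxy.symm
    · exact (herase z hz).1 (Nat.one_le_iff_ne_zero.2 hdeg) x hx hzx'.symm hzx.symm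

end PartitionCut

section Packing

variable {ι κ : Type*} {k : ℕ} {E F T : Finset β} {V X : Finset α} {π : α → ι}

theorem Tight.inter_of_edgesIn (h : Sparse ends k F) (hX : Tight ends k F X)
    (hF : EdgesIn ends F V) (hXV : (X ∩ V).Nonempty) : Tight ends k F (X ∩ V) := by
  have hsparse := h (X ∩ V) hXV
  have hinside : inside ends F (X ∩ V) = inside ends F X := by
    rw [inside_inter, hF.inside_eq, inter_eq_left.2 inside_subset]
  have hcard := Nat.mul_le_mul_left k (card_le_card (inter_subset_left : X ∩ V ⊆ X))
  have htight := hX.2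
  refine ⟨hXV, ?_⟩
  rw [hinside] at hsparse ⊢
  omega

theorem sparse_empty (ends : β → Sym2 α) (k : ℕ) : Sparse ends k ∅ := fun X hX => by
  rw [inside, filter_empty, card_empty, zero_add]
  exact Nat.le_mul_of_pos_right k hX.card_pos

theorem exists_sparse_tight_of_le_crossing (hV : V.Nonempty) (hEV : EdgesIn ends E V)
    (h : ∀ π : α → Finset α, k * #(V.image π) ≤ #(crossing ends E π) + k) :
    ∃ H ⊆ E, Sparse ends k H ∧ Tight ends k H V := by
  obtain ⟨H, hH, hmax⟩ := exists_max_image {H ∈ E.powerset | Sparse ends k H} card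
    ⟨∅, mem_filter.2 ⟨empty_mem_powerset E, sparse_empty ends k⟩⟩
  obtain ⟨hHE, hH⟩ := mem_filter.1 hH
  rw [mem_powerset] at hHE
  have hHV := hEV.mono hHE
  obtain ⟨π, hcount, hπ⟩ := hH.exists_partition V
  rw [hHV.inside_eq] at hcount
  have hcross : crossing ends E π = crossing ends H π := by
    refine crossing_eq_of_subset hHE fun e heE heH x hx y hy => ?_
    have hn : ¬ Sparse ends k (insert e H) := fun hs => by
      have hle := hmax _ (mem_filter.2 ⟨mem_powerset.2 (insert_subset heE hHE), hs⟩)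
      rw [card_insert_of_notMem heH] at hle
      omega
    obtain ⟨X, hX, heX⟩ := hH.exists_tight_of_not_insert hn
    have hmem : ∀ z ∈ ends e, z ∈ X ∩ V := fun z hz => mem_inter.2 ⟨heX z hz, hEV e heE z hz⟩
    exact hπ (X ∩ V) inter_subset_right (hX.inter_of_edgesIn hH hHV ⟨x, hmem x hx⟩) x (hmem x hx)
      y (hmem y hy)
  refine ⟨H, hHE, hH, hV, ?_⟩
  have hle := h π
  have hsparse := hH V hV
  rw [hcross] at hle
  rw [hHV.inside_eq] at hsparse ⊢
  omega

theorem Connects.exists_mem_crossing (hT : Connects ends T V) (hTV : EdgesIn ends T V) {x y : α}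
    (hx : x ∈ V) (hy : y ∈ V) (hxy : π y ≠ π x) :
    ∃ e ∈ T, ∃ p q, ends e = s(p, q) ∧ π p = π x ∧ π q ≠ π x := by
  obtain ⟨e, he, p, q, hpq, hp, hq⟩ := hT {z ∈ V | π z = π x} ⟨x, hx, mem_filter.2 ⟨hx, rfl⟩⟩
    ⟨y, hy, fun h => hxy (mem_filter.1 h).2⟩
  have hqV := hTV e he q (hpq ▸ Sym2.mem_mk_right p q)
  exact ⟨e, he, p, q, hpq, (mem_filter.1 hp).2, fun h => hq (mem_filter.2 ⟨hqV, h⟩)⟩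

/-- A crossing edge stops crossing when the two classes it joins are merged. -/
theorem Connects.card_image_le [DecidableEq ι] (hT : Connects ends T V) (hTV : EdgesIn ends T V)
    (π : α → ι) : #(V.image π) ≤ #(crossing ends T π) + 1 := by
  induction hn : #(crossing ends T π) using Nat.strong_induction_on generalizing π with | _ n ih =>
  by_contra! hlt
  obtain ⟨i, hi, j, hj, hij⟩ := one_lt_card.1 (by omega : 1 < #(V.image π))
  obtain ⟨x, hx, rfl⟩ := mem_image.1 hi
  obtain ⟨y, hy, rfl⟩ := mem_image.1 hj
  obtain ⟨e, he, p, q, hpq, hp, hq⟩ := hT.exists_mem_crossing hTV hx hy hij.symm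
  have he_cross : e ∈ crossing ends T π :=
    mem_crossing.2 ⟨he, p, hpq ▸ Sym2.mem_mk_left p q, q, hpq ▸ Sym2.mem_mk_right p q,
      fun h => hq (h ▸ hp)⟩
  let merged : α → ι := fun z => if π z = π x then π q else π z
  have hcross : crossing ends T merged ⊆ (crossing ends T π).erase e := by
    intro f hf
    obtain ⟨hfT, a, ha, b, hb, hab⟩ := mem_crossing.1 hf
    refine mem_erase.2 ⟨?_, mem_crossing.2 ⟨hfT, a, ha, b, hb, fun h => hab (by simp [merged, h])⟩⟩
    rintro rfl
    rw [hpq, Sym2.mem_iff] at ha hb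
    grind
  have himage : V.image π ⊆ insert (π x) (V.image merged) := by
    intro i hi
    obtain ⟨z, hz, rfl⟩ := mem_image.1 hi
    rw [mem_insert, or_iff_not_imp_left]
    exact fun hzx => mem_image.2 ⟨z, hz, if_neg hzx⟩
  have hcard := card_le_card hcross
  have hcard_erase := card_erase_add_one he_cross
  have hmerged := ih _ (by omega) merged rfl
  have hle := (card_le_card himage).trans (card_insert_le _ _)
  omega

theorem exists_sparse_tight_of_connects [Fintype κ] {T : κ → Finset β} (hV : V.Nonempty)
    (hEV : EdgesIn ends E V) (hTE : ∀ i, T i ⊆ E) (hT : Pairwise (Function.onFun Disjoint T))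
    (hconn : ∀ i, Connects ends (T i) V) :
    ∃ H ⊆ E, Sparse ends (Fintype.card κ) H ∧ Tight ends (Fintype.card κ) H V := by
  refine exists_sparse_tight_of_le_crossing hV hEV fun π => ?_
  have hdisj : Set.PairwiseDisjoint (univ : Finset κ) fun i => crossing ends (T i) π :=
    fun i _ j _ hij => (hT hij).mono crossing_subset crossing_subset
  have hunion : univ.biUnion (fun i => crossing ends (T i) π) ⊆ crossing ends E π :=
    biUnion_subset.2 fun i _ => crossing_mono (hTE i)
  calc Fintype.card κ * #(V.image π) = ∑ _i : κ, #(V.image π) := by simp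
    _ ≤ ∑ i : κ, (#(crossing ends (T i) π) + 1) :=
      sum_le_sum fun i _ => (hconn i).card_image_le (hEV.mono (hTE i)) π
    _ = #(univ.biUnion fun i => crossing ends (T i) π) + Fintype.card κ := by
      rw [sum_add_distrib, card_biUnion hdisj]
      simp
    _ ≤ #(crossing ends E π) + Fintype.card κ := by gcongr

end Packing

section DegTwoFour

variable {E H H₀ : Finset β} {V S : Finset α}

theorem Connects.deg_pos (hH : Connects ends H V) (hV : 2 ≤ #V) {v : α} (hv : v ∈ V) :
    0 < deg ends H v := by
  obtain ⟨u, hu, huv⟩ := exists_mem_ne hV v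
  obtain ⟨e, he, x, y, hxy, hx, -⟩ := hH {v} ⟨v, hv, mem_singleton_self v⟩
    ⟨u, hu, notMem_singleton.2 huv⟩
  rw [mem_singleton] at hx
  exact card_pos.2 ⟨e, mem_filter.2 ⟨he, hxy ▸ hx ▸ Sym2.mem_mk_left x y⟩⟩

/-- Counting the edges of `H`: it has `2 |V| - 2` edges, more than `5 |S|` edge ends in `S` and at
most `2 |S| - 2` edges inside `S`, so few edges are left inside `V \ S`. -/
theorem Tight.three_mul_card_add_card_inside_sdiff_lt (hH : Sparse ends 2 H)
    (hHV : Tight ends 2 H V) (hHEV : EdgesIn ends H V) (hS : ∀ v ∈ S, 5 ≤ deg ends H v)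
    (hS' : ∃ v ∈ S, 5 < deg ends H v) :
    3 * #S + #(inside ends H (V \ S)) + 4 < 2 * #V := by
  have hsum := sum_deg_add_card_inside hHEV (fun e he => hH.not_isDiag he) S
  have hlt : ∑ v ∈ S, 5 < ∑ v ∈ S, deg ends H v := sum_lt_sum hS hS'
  rw [sum_const, smul_eq_mul] at hlt
  have hsparse := hH S (hS'.imp fun _ h => h.1)
  have htight := hHV.2
  rw [hHEV.inside_eq] at htight
  omega

theorem Tight.hasCut_of_obstruction (hl : ∀ e ∈ E, ¬ (ends e).IsDiag) (hEV : EdgesIn ends E V)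
    (hHE : H ⊆ E) (hH : Sparse ends 2 H) (hHV : Tight ends 2 H V) (hSV : S ⊆ V)
    (hdeg : ∀ v ∈ S, 5 ≤ deg ends H v) (hdeg' : ∃ v ∈ S, 5 < deg ends H v)
    (hS : ∀ e ∈ E, e ∉ H → (∀ x ∈ ends e, x ∈ V \ S) →
      ∃ X ⊆ V \ S, Tight ends 2 H X ∧ ∀ x ∈ ends e, x ∈ X) :
    HasCut ends E (V \ S) (2 * #S + 10) := by
  obtain ⟨π, hcount, hπ⟩ := hH.exists_partition (V \ S)
  have hcross : crossing ends (inside ends E (V \ S)) π =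
      crossing ends (inside ends H (V \ S)) π := by
    refine crossing_eq_of_subset (inside_mono hHE subset_rfl) fun e heE heH x hx y hy => ?_
    obtain ⟨heE, heV⟩ := mem_inside.1 heE
    obtain ⟨X, hXV, hX, heX⟩ := hS e heE (fun h => heH (mem_inside.2 ⟨h, heV⟩)) heV
    exact hπ X hXV hX x (heX x hx) y (heX y hy)
  refine (hasCut_of_partition hl (V \ S) π).mono ?_
  have hlt := hHV.three_mul_card_add_card_inside_sdiff_lt hH (hEV.mono hHE) hdeg hdeg'
  have hcard := card_sdiff_add_card_eq_card hSV
  rw [hcross]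
  omega

theorem exists_connects_deg_two_four (hV : 2 ≤ #V) (hEV : EdgesIn ends E V)
    (hl : ∀ e ∈ E, ¬ (ends e).IsDiag) (hH₀E : H₀ ⊆ E) (hH₀ : Sparse ends 2 H₀)
    (hH₀V : Tight ends 2 H₀ V)
    (hω : ∀ W ⊆ V, ∀ k, SplitsInto ends E (V \ W) k → 7 * k ≤ 2 * #W + 9) :
    ∃ J ⊆ E, Connects ends J V ∧ ∀ v ∈ V, deg ends J v = 2 ∨ deg ends J v = 4 := by
  obtain ⟨H, hHE, hH, hHV, hdeg | ⟨S, hSV, hdeg, hdeg', hS⟩⟩ :=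
    exists_deg_le_or_obstruction two_pos (fun _ => 5) hH₀E hH₀ hH₀V
  · obtain ⟨J, hJH, hJ, heven⟩ := hHV.exists_connects_even hH (hEV.mono hHE)
    refine ⟨J, hJH.trans hHE, hJ, fun v hv => ?_⟩
    have hle := (deg_mono (ends := ends) hJH v).trans (hdeg v hv)
    have hpos := hJ.deg_pos hV hv
    obtain ⟨m, hm⟩ := heven v hv
    omega
  · obtain ⟨W, hW, k, hk, hle⟩ := hHV.hasCut_of_obstruction hl hEV hHE hH hSV hdeg hdeg' hS
    have hsplit : SplitsInto ends E (V \ (S ∪ W)) k := by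
      rwa [← sup_eq_union, ← sdiff_sdiff]
    have hωk := hω (S ∪ W) (union_subset hSV (hW.trans sdiff_subset)) k hsplit
    have hcard := card_union_le S W
    omega

end DegTwoFour

section Toughness

variable {ι : Type*} {k d : ℕ} {E J : Finset β} {U V X : Finset α} {a b : α} {π : α → ι}

theorem mem_crossing_mem {e : β} :
    e ∈ crossing ends E (· ∈ X) ↔ e ∈ E ∧ ∃ x y, ends e = s(x, y) ∧ x ∈ X ∧ y ∉ X := by
  rw [mem_crossing]
  refine and_congr_right fun _ => ⟨?_, ?_⟩
  · rintro ⟨x, hx, y, hy, hxy⟩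
    have hne : x ≠ y := fun h => hxy (h ▸ rfl)
    have he := (Sym2.mem_and_mem_iff hne).1 ⟨hx, hy⟩
    by_cases hxX : x ∈ X
    · exact ⟨x, y, he, hxX, fun hyX => hxy (by simp [hxX, hyX])⟩
    · exact ⟨y, x, he.trans Sym2.eq_swap, by_contra fun hyX => hxy (by simp [hxX, hyX]), hxX⟩
  · rintro ⟨x, y, he, hx, hy⟩
    exact ⟨x, he ▸ Sym2.mem_mk_left x y, y, he ▸ Sym2.mem_mk_right x y, by simp [hx, hy]⟩

theorem splitsInto_two (haU : a ∈ U) (haX : a ∈ X) (hbU : b ∈ U) (hbX : b ∉ X)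
    (h : ∀ e ∈ crossing ends E (· ∈ X), ∃ x ∈ ends e, x ∉ U) : SplitsInto ends E U 2 := by
  refine ⟨fun v => if v ∈ X then 0 else 1, card_eq_two.2 ⟨0, 1, zero_ne_one, ?_⟩,
    fun e he x hx y hy => ?_⟩
  · refine (image_subset_iff.2 fun v _ => by split_ifs <;> simp).antisymm ?_
    exact insert_subset (mem_image.2 ⟨a, haU, if_pos haX⟩)
      (singleton_subset_iff.2 (mem_image.2 ⟨b, hbU, if_neg hbX⟩))
  · have hxy : (x ∈ X) = (y ∈ X) := by
      by_contra hne
      obtain ⟨z, hz, hzU⟩ := h e (mem_crossing.2 ⟨inside_subset he, x, hx, y, hy, hne⟩)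
      exact hzU ((mem_inside.1 he).2 z hz)
    simp only [hxy]

/-- Delete from each edge between `X` and its complement an end other than `a` and `b`. -/
theorem exists_splitsInto_two_of_not_adj (hEV : EdgesIn ends E V) (hXV : X ⊆ V) (ha : a ∈ X)
    (hb : b ∈ V) (hbX : b ∉ X) (hab : ∀ e ∈ E, ends e ≠ s(a, b)) :
    ∃ W ⊆ V, #W ≤ #(crossing ends E (· ∈ X)) ∧ SplitsInto ends E (V \ W) 2 := by
  have hend : ∀ e ∈ crossing ends E (· ∈ X), ∃ z ∈ ends e, z ≠ a ∧ z ≠ b := by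
    intro e he
    obtain ⟨heE, x, y, hxy, hx, hy⟩ := mem_crossing_mem.1 he
    have hya : y ≠ a := fun h => hy (h ▸ ha)
    have hxb : x ≠ b := fun h => hbX (h ▸ hx)
    by_cases hxa : x = a
    · exact ⟨y, hxy ▸ Sym2.mem_mk_right x y, hya, fun hyb => hab e heE (hxa ▸ hyb ▸ hxy)⟩
    · exact ⟨x, hxy ▸ Sym2.mem_mk_left x y, hxa, hxb⟩
  have : Nonempty α := ⟨a⟩
  choose! z hz hza hzb using hend
  have notMem_image : ∀ c, (∀ e ∈ crossing ends E (· ∈ X), z e ≠ c) →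
      c ∉ (crossing ends E (· ∈ X)).image z := fun c hc h =>
    let ⟨e, he, hec⟩ := mem_image.1 h
    hc e he hec
  refine ⟨(crossing ends E (· ∈ X)).image z, image_subset_iff.2 fun e he => ?_, card_image_le,
    splitsInto_two (mem_sdiff.2 ⟨hXV ha, notMem_image a hza⟩) ha
      (mem_sdiff.2 ⟨hb, notMem_image b hzb⟩) hbX fun e he => ?_⟩
  · exact hEV e (crossing_subset he) _ (hz e he)
  · exact ⟨z e, hz e he, fun h => (mem_sdiff.1 h).2 (mem_image_of_mem z he)⟩

theorem card_mul_card_sdiff_le_card_crossing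
    (h : ∀ a ∈ X, ∀ b ∈ V \ X, ∃ e ∈ E, ends e = s(a, b)) :
    #X * #(V \ X) ≤ #(crossing ends E (· ∈ X)) := by
  rw [← card_product]
  refine card_le_card_of_forall_subsingleton (fun (p : α × α) e => ends e = s(p.1, p.2)) ?_ ?_
  · rintro ⟨a, b⟩ hab
    obtain ⟨ha, hb⟩ := mem_product.1 hab
    obtain ⟨e, he, hends⟩ := h a ha b hb
    exact ⟨e, mem_crossing_mem.2 ⟨he, a, b, hends, ha, (mem_sdiff.1 hb).2⟩, hends⟩
  · rintro e - ⟨a, b⟩ ⟨hab, he⟩ ⟨c, d⟩ ⟨hcd, he'⟩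
    rw [mem_product, mem_sdiff] at hab hcd
    rw [he, Sym2.eq_iff] at he'
    grind

theorem min_le_card_crossing (hEV : EdgesIn ends E V)
    (hd : ∀ W ⊆ V, SplitsInto ends E (V \ W) 2 → d ≤ #W) (hX : X.Nonempty) (hXV : X ⊂ V) :
    min d (#V - 1) ≤ #(crossing ends E (· ∈ X)) := by
  by_cases hadj : ∀ a ∈ X, ∀ b ∈ V \ X, ∃ e ∈ E, ends e = s(a, b)
  · have hprod := card_mul_card_sdiff_le_card_crossing hadj
    have hcard := card_sdiff_add_card_eq_card hXV.1
    have hpos : 0 < #X := hX.card_pos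
    have hpos' : 0 < #(V \ X) := (sdiff_nonempty.2 hXV.2).card_pos
    have hle : #X + #(V \ X) ≤ #X * #(V \ X) + 1 := by nlinarith
    omega
  · push Not at hadj
    obtain ⟨a, ha, b, hb, hab⟩ := hadj
    obtain ⟨hbV, hbX⟩ := mem_sdiff.1 hb
    obtain ⟨W, hWV, hW, hsplit⟩ := exists_splitsInto_two_of_not_adj hEV hXV.1 ha hbV hbX hab
    exact (min_le_left _ _).trans ((hd W hWV hsplit).trans hW)

theorem sum_deg_map_crossing [DecidableEq ι] (hEV : EdgesIn ends E V) (π : α → ι) :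
    ∑ i ∈ V.image π, deg (fun e => (ends e).map π) (crossing ends E π) i =
      2 * #(crossing ends E π) := by
  refine sum_deg_eq_two_mul_card (fun e he i hi => ?_) fun e he => ?_
  · obtain ⟨x, hx, rfl⟩ := Sym2.mem_map.1 hi
    exact mem_image_of_mem π (hEV e (crossing_subset he) x hx)
  · obtain ⟨-, x, hx, y, hy, hxy⟩ := mem_crossing.1 he
    have hne : x ≠ y := fun h => hxy (h ▸ rfl)
    rw [(Sym2.mem_and_mem_iff hne).1 ⟨hx, hy⟩, Sym2.map_mk, Sym2.mk_isDiag_iff]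
    exact hxy

theorem card_crossing_fiber_le_deg (hEV : EdgesIn ends E V) {i : ι}
    (hX : ∀ v ∈ V, v ∈ X ↔ π v = i) :
    #(crossing ends E (· ∈ X)) ≤ deg (fun e => (ends e).map π) (crossing ends E π) i := by
  refine card_le_card fun e he => ?_
  obtain ⟨heE, x, y, hxy, hx, hy⟩ := mem_crossing_mem.1 he
  have hxe := hxy ▸ Sym2.mem_mk_left x y
  have hye := hxy ▸ Sym2.mem_mk_right x y
  have hxi := (hX x (hEV e heE x hxe)).1 hx
  refine mem_filter.2 ⟨mem_crossing.2 ⟨heE, x, hxe, y, hye, fun h => hy ?_⟩,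
    Sym2.mem_map.2 ⟨x, hxe, hxi⟩⟩
  exact (hX y (hEV e heE y hye)).2 (h ▸ hxi)

theorem mul_card_image_le_of_min_le_card_crossing [DecidableEq ι] (hEV : EdgesIn ends E V)
    (hk : 2 * k ≤ #V)
    (h : ∀ X ⊂ V, X.Nonempty → min (2 * k) (#V - 1) ≤ #(crossing ends E (· ∈ X))) (π : α → ι) :
    k * #(V.image π) ≤ #(crossing ends E π) + k := by
  obtain hone | hone := le_or_gt #(V.image π) 1
  · exact (mul_le_of_le_one_right' hone).trans (Nat.le_add_left _ _)
  have hclass : ∀ i ∈ V.image π,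
      min (2 * k) (#V - 1) ≤ deg (fun e => (ends e).map π) (crossing ends E π) i := by
    intro i hi
    obtain ⟨j, hj, hji⟩ := exists_mem_ne hone i
    obtain ⟨v, hv, rfl⟩ := mem_image.1 hi
    obtain ⟨w, hw, rfl⟩ := mem_image.1 hj
    exact (h {z ∈ V | π z = π v} (filter_ssubset.2 ⟨w, hw, hji⟩) ⟨v, mem_filter.2 ⟨hv, rfl⟩⟩).trans
      (card_crossing_fiber_le_deg hEV fun z hz => mem_filter.trans (and_iff_right hz))
  have hsum := card_nsmul_le_sum _ _ _ hclass
  rw [sum_deg_map_crossing hEV, smul_eq_mul] at hsum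
  have hcard : #(V.image π) ≤ #V := card_image_le
  obtain hV | hV := Nat.lt_or_ge (2 * k) #V
  · rw [min_eq_left (by omega)] at hsum
    nlinarith
  · obtain ⟨m, hm⟩ : ∃ m, 2 * k = m + 1 := ⟨2 * k - 1, by omega⟩
    rw [show min (2 * k) (#V - 1) = m by omega] at hsum
    nlinarith

theorem connects_of_forall_exists_ends (h : ∀ a ∈ V, ∀ b ∈ V, a ≠ b → ∃ e ∈ J, ends e = s(a, b)) :
    Connects ends J V := by
  rintro A ⟨x, hx, hxA⟩ ⟨y, hy, hyA⟩
  obtain ⟨e, he, hends⟩ := h x hx y hy fun hxy => hyA (hxy ▸ hxA)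
  exact ⟨e, he, x, y, hends, hxA, hyA⟩

theorem exists_mem_ends_eq_of_card_le (hd : ∀ W ⊆ V, SplitsInto ends E (V \ W) 2 → d ≤ #W)
    (hV : #V ≤ d + 1) (ha : a ∈ V) (hb : b ∈ V) (hab : a ≠ b) : ∃ e ∈ E, ends e = s(a, b) := by
  by_contra! hne
  have hpair : {a, b} ⊆ V := insert_subset ha (singleton_subset_iff.2 hb)
  have hsplit : SplitsInto ends E (V \ (V \ {a, b})) 2 := by
    rw [sdiff_sdiff_right_self, inf_eq_inter, inter_eq_right.2 hpair]
    refine splitsInto_two (mem_insert_self a {b}) (mem_singleton_self a) (by simp)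
      (notMem_singleton.2 hab.symm) fun e he => ?_
    obtain ⟨heE, x, y, hxy, hx, hy⟩ := mem_crossing_mem.1 he
    rw [mem_singleton] at hx hy
    refine ⟨y, hxy ▸ Sym2.mem_mk_right x y, fun hyab => hne e heE ?_⟩
    rw [hxy, hx, mem_singleton.1 (mem_of_mem_insert_of_ne hyab hy)]
  have hle := hd _ sdiff_subset hsplit
  have hcard := card_sdiff_add_card_eq_card hpair
  rw [card_pair hab] at hcard
  omega

theorem exists_triangle (hV : #V = 3) (h : ∀ a ∈ V, ∀ b ∈ V, a ≠ b → ∃ e ∈ E, ends e = s(a, b)) :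
    ∃ J ⊆ E, Connects ends J V ∧ ∀ v ∈ V, deg ends J v = 2 := by
  obtain ⟨a, b, c, hab, hac, hbc, rfl⟩ := card_eq_three.1 hV
  obtain ⟨e, heE, he⟩ := h a (by simp) b (by simp) hab
  obtain ⟨f, hfE, hf⟩ := h a (by simp) c (by simp) hac
  obtain ⟨g, hgE, hg⟩ := h b (by simp) c (by simp) hbc
  have hef : e ≠ f := by rintro rfl; rw [he, Sym2.eq_iff] at hf; grind
  have heg : e ≠ g := by rintro rfl; rw [he, Sym2.eq_iff] at hg; grind
  have hfg : f ≠ g := by rintro rfl; rw [hf, Sym2.eq_iff] at hg; grind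
  refine ⟨{e, f, g}, by simp [insert_subset_iff, heE, hfE, hgE],
    connects_of_forall_exists_ends ?_, ?_⟩
  · have hswap : ∀ x y : α, s(y, x) = s(x, y) := fun _ _ => Sym2.eq_swap
    simp only [mem_insert, mem_singleton]
    grind
  · have hdeg : ∀ v, deg ends {e, f, g} v =
        (if v = b ∨ v = c then 1 else 0) + (if v = a ∨ v = c then 1 else 0) +
          (if v = a ∨ v = b then 1 else 0) := by
      intro v
      rw [deg_insert (by simp [hef, heg]), deg_insert (by simpa using hfg), ← insert_empty_eq g,
        deg_insert (notMem_empty g), he, hf, hg]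
      simp [deg]
    simp only [mem_insert, mem_singleton, hdeg]
    grind

theorem exists_connects_deg_two_four_of_tough (hV : 3 ≤ #V) (hEV : EdgesIn ends E V)
    (hl : ∀ e ∈ E, ¬ (ends e).IsDiag)
    (hω : ∀ W ⊆ V, ∀ k, SplitsInto ends E (V \ W) k → 7 * k ≤ max 7 (2 * #W)) :
    ∃ J ⊆ E, Connects ends J V ∧ ∀ v ∈ V, deg ends J v = 2 ∨ deg ends J v = 4 := by
  have hd : ∀ W ⊆ V, SplitsInto ends E (V \ W) 2 → 4 ≤ #W := fun W hW h => by
    have := hω W hW 2 h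
    omega
  obtain hthree | hfour := hV.eq_or_lt
  · obtain ⟨J, hJE, hJ, hdeg⟩ := exists_triangle hthree.symm fun a ha b hb =>
      exists_mem_ends_eq_of_card_le hd (by omega) ha hb
    exact ⟨J, hJE, hJ, fun v hv => .inl (hdeg v hv)⟩
  · obtain ⟨H, hHE, hH, hHV⟩ := exists_sparse_tight_of_le_crossing (k := 2)
      (card_pos.1 (by omega)) hEV (mul_card_image_le_of_min_le_card_crossing hEV hfour
        fun X hXV hX => min_le_card_crossing hEV hd hX hXV)
    refine exists_connects_deg_two_four (by omega) hEV hl hHE hH hHV fun W hW k hk => ?_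
    have := hω W hW k hk
    omega

end Toughness

/-- The multigraph `G` has vertex set `V` and edge set `E`, and `ends` gives the ends of its edges.
This is how the results on finite edge sets above are applied to `Graph`. -/
structure Encodes (G : Graph α β) (ends : β → Sym2 α) (V : Finset α) (E : Finset β) : Prop where
  mem_vertexSet (v : α) : v ∈ G.vertexSet ↔ v ∈ V
  isLink_iff (e : β) (x y : α) : G.IsLink e x y ↔ e ∈ E ∧ ends e = s(x, y)

theorem exists_encodes {G : Graph α β} (hV : G.vertexSet.Finite) (hE : G.edgeSet.Finite)
    (hne : G.vertexSet.Nonempty) : ∃ ends V E, Encodes G ends V E := by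
  have hlink : ∀ e ∈ G.edgeSet, ∃ z : Sym2 α, ∀ x y, G.IsLink e x y ↔ z = s(x, y) := by
    intro e he
    obtain ⟨x, y, hxy⟩ := Graph.exists_isLink_of_mem_edgeSet he
    exact ⟨s(x, y), fun _ _ => hxy.isLink_iff_sym2_eq⟩
  have : Nonempty (Sym2 α) := ⟨s(hne.some, hne.some)⟩
  choose! ends hends using hlink
  refine ⟨ends, hV.toFinset, hE.toFinset, fun v => hV.mem_toFinset.symm, fun e x y => ?_⟩
  rw [hE.mem_toFinset]
  exact ⟨fun h => ⟨h.edge_mem, (hends e h.edge_mem x y).1 h⟩, fun h => (hends e h.1 x y).2 h.2⟩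

theorem isEulerian_of_isFactor {G H : Graph α β} {A : Set ℕ} (hA : ∀ d ∈ A, Even d)
    (hH : H.IsFactor G A) (hc : H.IsConnected) : H.IsEulerian :=
  ⟨hc, fun v hv => hA _ (hH.2 v hv)⟩

namespace Encodes

variable {G : Graph α β} {V : Finset α} {E : Finset β}

theorem ncard_vertexSet (h : Encodes G ends V E) : G.vertexSet.ncard = #V := by
  rw [← Set.ncard_coe_finset V]
  exact congrArg _ (Set.ext h.mem_vertexSet)

theorem edgesIn (h : Encodes G ends V E) : EdgesIn ends E V := by
  rintro e he x ⟨y, hxy⟩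
  exact (h.mem_vertexSet x).1 ((h.isLink_iff e x y).2 ⟨he, hxy⟩).left_mem

theorem not_isDiag [G.Loopless] (h : Encodes G ends V E) {e : β} (he : e ∈ E) :
    ¬ (ends e).IsDiag := by
  induction hz : ends e with | _ x y =>
  rw [Sym2.mk_isDiag_iff]
  rintro rfl
  exact Graph.Loopless.not_isLoopAt e x ((h.isLink_iff e x x).2 ⟨he, hz⟩)

theorem deleteVerts (h : Encodes G ends V E) (W : Finset α) :
    Encodes (G.deleteVerts (W : Set α)) ends (V \ W) (inside ends E (V \ W)) := by
  refine ⟨fun v => by simp [h.mem_vertexSet], fun e x y => ?_⟩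
  rw [Graph.deleteVerts_isLink, h.isLink_iff, mem_inside]
  constructor
  · rintro ⟨⟨he, hxy⟩, hx, hy⟩
    have hV := h.edgesIn e he
    rw [hxy] at hV ⊢
    simp_all
  · rintro ⟨⟨he, hV⟩, hxy⟩
    rw [hxy] at hV
    simp_all

theorem of_isSpanningSubgraph (h : Encodes G ends V E) {T : Graph α β} (hT : T ≤s G) :
    Encodes T ends V (E.filter (· ∈ T.edgeSet)) := by
  refine ⟨fun v => by rw [hT.vertexSet_eq, h.mem_vertexSet], fun e x y => ?_⟩
  rw [mem_filter]
  refine ⟨fun he => ?_, fun ⟨⟨he, heT⟩, hxy⟩ => ?_⟩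
  · obtain ⟨heE, hxy⟩ := (h.isLink_iff e x y).1 (he.mono hT.le)
    exact ⟨⟨heE, he.edge_mem⟩, hxy⟩
  · exact (hT.le.isLink_iff heT).2 ((h.isLink_iff e x y).2 ⟨he, hxy⟩)

theorem restrict (h : Encodes G ends V E) {J : Finset β} (hJ : J ⊆ E) :
    Encodes (G.restrict (J : Set β)) ends V J := by
  refine ⟨h.mem_vertexSet, fun e x y => ?_⟩
  rw [Graph.restrict_isLink, h.isLink_iff, mem_coe]
  exact ⟨fun ⟨he, _, hxy⟩ => ⟨he, hxy⟩, fun ⟨he, hxy⟩ => ⟨he, hJ he, hxy⟩⟩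

theorem degree_eq (h : Encodes G ends V E) (v : α) : G.degree v = deg ends E v := by
  rw [Graph.degree, deg, ← Set.ncard_coe_finset]
  congr 1
  ext e
  simp only [Graph.mem_incidenceSet, Graph.Inc, h.isLink_iff, mem_coe, mem_filter,
    Sym2.mem_iff_exists, exists_and_left]

theorem connects (h : Encodes G ends V E) (hG : G.IsConnected) : Connects ends E V := by
  rintro A ⟨x, hxV, hx⟩ ⟨y, hyV, hy⟩
  obtain ⟨p⟩ := hG.preconnected ⟨x, (h.mem_vertexSet x).2 hxV⟩ ⟨y, (h.mem_vertexSet y).2 hyV⟩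
  obtain ⟨d, -, hfst, hsnd⟩ := p.exists_boundary_dart {v | (v : α) ∈ A} hx hy
  obtain ⟨-, e, he⟩ := d.adj
  obtain ⟨heE, hends⟩ := (h.isLink_iff e _ _).1 he
  exact ⟨e, heE, _, _, hends, hfst, hsnd⟩

theorem isConnected (h : Encodes G ends V E) (hV : V.Nonempty) (hE : Connects ends E V) :
    G.IsConnected := by
  obtain ⟨r, hr⟩ := hV
  have : Nonempty G.vertexSet := ⟨⟨r, (h.mem_vertexSet r).2 hr⟩⟩
  refine ⟨fun u v => ?_⟩
  by_contra hn
  let reached : α → Prop := fun x => ∃ hx, G.toSimpleGraph.Reachable u ⟨x, hx⟩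
  have hu : reached u := ⟨u.2, .refl _⟩
  have hv : ¬ reached v := fun ⟨_, h⟩ => hn h
  obtain ⟨e, he, x, y, hxy, hx, hy⟩ := hE (V.filter reached)
    ⟨u, (h.mem_vertexSet u).1 u.2, by simp [hu, ← h.mem_vertexSet]⟩
    ⟨v, (h.mem_vertexSet v).1 v.2, by simp [hv]⟩
  have hlink := (h.isLink_iff e x y).2 ⟨he, hxy⟩
  obtain ⟨hxV, hux⟩ := (mem_filter.1 hx).2
  have hadj : G.toSimpleGraph.Adj ⟨x, hxV⟩ ⟨y, hlink.right_mem⟩ :=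
    ⟨fun heq => hy (Subtype.mk.inj heq ▸ hx), e, hlink⟩
  exact hy (mem_filter.2 ⟨(h.mem_vertexSet y).1 hlink.right_mem, _, hux.trans hadj.reachable⟩)

theorem le_numComponents (h : Encodes G ends V E) {k : ℕ} (hk : SplitsInto ends E V k) :
    k ≤ G.numComponents := by
  obtain ⟨c, rfl, hc⟩ := hk
  have : Finite G.vertexSet := V.finite_toSet.subset fun v => (h.mem_vertexSet v).1
  have hadj : ∀ u v : G.vertexSet, G.toSimpleGraph.Adj u v → c u = c v := by
    rintro u v ⟨-, e, he⟩
    obtain ⟨heE, hends⟩ := (h.isLink_iff e u v).1 he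
    exact hc e (mem_inside.2 ⟨heE, h.edgesIn e heE⟩) u (by simp [hends]) v (by simp [hends])
  have hwalk : ∀ u v : G.vertexSet, G.toSimpleGraph.Walk u v → c u = c v := by
    intro u v p
    induction p with
    | nil => rfl
    | cons huv _ ih => exact (hadj _ _ huv).trans ih
  let color : G.toSimpleGraph.ConnectedComponent → V.image c := fun C =>
    C.lift (fun v : G.vertexSet => ⟨c v, mem_image_of_mem c ((h.mem_vertexSet v).1 v.2)⟩)
      fun v w p _ => Subtype.ext (hwalk v w p)
  have hcolor : Function.Surjective color := by
    rintro ⟨i, hi⟩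
    obtain ⟨v, hv, rfl⟩ := mem_image.1 hi
    exact ⟨G.toSimpleGraph.connectedComponentMk ⟨v, (h.mem_vertexSet v).2 hv⟩, rfl⟩
  have hcard := Nat.card_le_card_of_surjective color hcolor
  rwa [Nat.card_eq_fintype_card, Fintype.card_coe] at hcard

theorem cast_le_of_splitsInto (h : Encodes G ends V E) {f : ℝ → ℝ}
    (hω : ∀ S ⊆ G.vertexSet, ((G.deleteVerts S).numComponents : ℝ) ≤ f S.ncard)
    {W : Finset α} (hW : W ⊆ V) {k : ℕ} (hk : SplitsInto ends E (V \ W) k) :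
    (k : ℝ) ≤ f #W := by
  have hk' : SplitsInto ends (inside ends E (V \ W)) (V \ W) k := by
    rwa [SplitsInto, inside_inside subset_rfl]
  have hcard := hω W fun v hv => (h.mem_vertexSet v).2 (hW hv)
  rw [Set.ncard_coe_finset] at hcard
  exact (Nat.cast_le.2 ((h.deleteVerts W).le_numComponents hk')).trans hcard

theorem seven_mul_le_of_numComponents_le (h : Encodes G ends V E)
    (hω : ∀ S ⊆ G.vertexSet,
      ((G.deleteVerts S).numComponents : ℝ) ≤ 2 / 7 * (S.ncard : ℝ) + 9 / 7) :
    ∀ W ⊆ V, ∀ k, SplitsInto ends E (V \ W) k → 7 * k ≤ 2 * #W + 9 := by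
  intro W hW k hk
  have hle : (k : ℝ) ≤ 2 / 7 * #W + 9 / 7 :=
    h.cast_le_of_splitsInto (f := fun s => 2 / 7 * s + 9 / 7) hω hW hk
  have : (7 * k : ℝ) ≤ 2 * #W + 9 := by linarith
  exact_mod_cast this

theorem seven_mul_le_of_isTough (h : Encodes G ends V E) (hG : G.IsTough (3 + 1 / 2)) :
    ∀ W ⊆ V, ∀ k, SplitsInto ends E (V \ W) k → 7 * k ≤ max 7 (2 * #W) := by
  intro W hW k hk
  have hle : (k : ℝ) ≤ max 1 (1 / (3 + 1 / 2) * (#W : ℝ)) :=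
    h.cast_le_of_splitsInto (f := fun s => max 1 (1 / (3 + 1 / 2) * s)) hG hW hk
  have : (7 * k : ℝ) ≤ max 7 (2 * (#W : ℝ)) := by
    rcases le_max_iff.1 hle with hle | hle
    · exact le_max_of_le_left (by linarith)
    · exact le_max_of_le_right (by linarith)
  exact_mod_cast this

theorem exists_sparse_tight (h : Encodes G ends V E) (hV : V.Nonempty) {m : ℕ}
    (hG : G.IsTreeConnected m) : ∃ H ⊆ E, Sparse ends m H ∧ Tight ends m H V := by
  obtain ⟨T, hT, hdisj⟩ := hG
  have hT' := fun i => h.of_isSpanningSubgraph (hT i).1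
  have hsparse := exists_sparse_tight_of_connects
    (T := fun i => E.filter (· ∈ (T i).edgeSet)) hV h.edgesIn (fun i => filter_subset _ _)
    (fun i j hij => disjoint_filter.2 fun e _ hei hej =>
      Set.disjoint_left.1 (hdisj i j hij) hei hej)
    fun i => (hT' i).connects (hT i).2.2.connected
  rwa [Fintype.card_fin] at hsparse

theorem exists_isFactor (h : Encodes G ends V E) (hV : V.Nonempty) {A : Set ℕ} {J : Finset β}
    (hJE : J ⊆ E) (hJ : Connects ends J V) (hA : ∀ v ∈ V, deg ends J v ∈ A) :
    ∃ H : Graph α β, H.IsFactor G A ∧ H.IsConnected := by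
  have hH := h.restrict hJE
  refine ⟨G.restrict J, ⟨⟨Graph.restrict_le, rfl⟩, fun v hv => ?_⟩, hH.isConnected hV hJ⟩
  rw [hH.degree_eq]
  exact hA v ((h.mem_vertexSet v).1 hv)

end Encodes

end Multigraph

end

open Multigraph in
theorem mainTheorem5 {α β : Type*} (G : Graph α β) [G.Loopless]
    (hV : G.vertexSet.Finite) (hE : G.edgeSet.Finite) :
    (G.IsTreeConnected 2 → 2 ≤ G.vertexSet.ncard →
      (∀ S : Set α, S ⊆ G.vertexSet →
        ((G.deleteVerts S).numComponents : ℝ) ≤ 2 / 7 * (S.ncard : ℝ) + 9 / 7) →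
      ∃ H : Graph α β, H.IsFactor G {2, 4} ∧ H.IsConnected) ∧
    (G.IsTough (3 + 1 / 2) → 3 ≤ G.vertexSet.ncard →
      ∃ H : Graph α β, H.IsFactor G {2, 4} ∧ H.IsConnected ∧ H.IsEulerian) := by
  rcases G.vertexSet.eq_empty_or_nonempty with hG | hG
  · simp [hG]
  obtain ⟨ends, V, E, h⟩ := exists_encodes hV hE hG
  have hV : V.Nonempty := hG.imp fun v => (h.mem_vertexSet v).1
  rw [h.ncard_vertexSet]
  constructor
  · intro htrees hcard hω
    obtain ⟨H, hHE, hH, hHV⟩ := h.exists_sparse_tight hV htrees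
    obtain ⟨J, hJE, hJ, hdeg⟩ := exists_connects_deg_two_four hcard h.edgesIn
      (fun _ => h.not_isDiag) hHE hH hHV (h.seven_mul_le_of_numComponents_le hω)
    exact h.exists_isFactor (A := {2, 4}) hV hJE hJ hdeg
  · intro htough hcard
    obtain ⟨J, hJE, hJ, hdeg⟩ := exists_connects_deg_two_four_of_tough hcard h.edgesIn
      (fun _ => h.not_isDiag) (h.seven_mul_le_of_isTough htough)
    obtain ⟨H, hH, hconn⟩ := h.exists_isFactor (A := {2, 4}) hV hJE hJ hdeg
    exact ⟨H, hH, hconn, isEulerian_of_isFactor (by rintro d (rfl | rfl) <;> decide) hH hconn⟩
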